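/- A ball quasi-Banach function space $X$ on $\mathbb R^n$ is given by a quasi-norm $\|\cdot\|_X$, with values in $[0,\infty]$, on the (Lebesgue) measurable functions on $\mathbb R^n$, with $X=\{f:\|f\|_X<\infty\}$, such that (i) $\|f\|_X=0$ implies $f=0$ a.e.; (ii) $|g|\le|f|$ a.e. implies $\|g\|_X\le\|f\|_X$; (iii) $0\le f_m\uparrow f$ a.e. implies $\|f_m\|_X\uparrow\|f\|_X$; (iv) $\chi_B\in X$ for every ball $B$. It is a ball Banach function space if moreover (v) $\|f+g\|_X\le\|f\|_X+\|g\|_X$ for all $f,g\in X$; (vi) for every ball $B$ there is $C_B>0$ with $\int_B|f|\le C_B\|f\|_X$ for all $f\in X$. For $p>0$, $X^p$ is the space with $\|f\|_{X^p}=\||f|^p\|_X^{1/p}$, and $X'$ is the associate space, with $\|f\|_{X'}=\sup\{\|fg\|_{L^1}: \|g\|_X=1\}$. Let $\mathcal M f(x)=\sup_{Q\ni x}|Q|^{-1}\int_Q|f|$ be the Hardy–Littlewood maximal operator, the supremum being over cubes $Q$; all cubes have positive side length $l(Q)$ and sides parallel to the axes. For a cube $Q$ let $Q^*$ be the cube with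 the same center and side length $l(Q^*)=100\sqrt n\,l(Q)$. **Lemma.** Let $X$ and $Y$ be ball quasi-Banach function spaces on $\mathbb R^n$, let $\alpha\in(0,n)$ and $0<p_0<q_0\le1$ with $$\frac1{q_0}=\frac1{p_0}-\frac{\alpha}{n}.$$ Assume that $X^{1/p_0}$ and $Y^{1/q_0}$ are ball Banach function spaces, that $$\bigl(Y^{1/q_0}\bigr)'=\Bigl(\bigl(X^{1/p_0}\bigr)'\Bigr)^{p_0/q_0}$$ as sets of measurable functions, and that $\mathcal M$ is bounded on $(Y^{1/q_0})'$, i.e. there is $C_0<\infty$ with $\|\mathcal Mf\|_{(Y^{1/q_0})'}\le C_0\|f\|_{(Y^{1/q_0})'}$ for all $f\in(Y^{1/q_0})'$. Then there is a constant $C>0$ such that for every sequence $(Q_j)_{j\ge1}$ of cubes and every sequence $(\lambda_j)_{j\ge1}$ of positive numbers, $$\Bigl\|\sum_{j=1}^\infty\lambda_j|Q_j|^{\alpha/n}\chi_{Q_j^*}\Bigr\|_Y\le C\,\Bigl\|\sum_{j=1}^\infty\lambda_j\chi_{Q_j}\Bigr\|_X .$$ (Both sides may be $+\infty$.) -/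

import Mathlib

open MeasureTheory Filter Topology
open scoped ENNReal NNReal

noncomputable section

namespace BallSpace

/-- The space `ℝⁿ` with its Euclidean norm and Lebesgue measure. -/
abbrev Rn (n : ℕ) : Type := EuclideanSpace ℝ (Fin n)

/-- A functional `ρ` on `[0, ∞]`-valued functions on `ℝⁿ`. A lattice quasi-norm `‖·‖_X` depends only
on the modulus of its argument, and is recorded by `ρ |f| = ‖f‖_X`, with value `∞` when `f` is not in
`X`. The values of `ρ` at functions that are not Lebesgue measurable are never used. The value `∞`
is allowed for functions because series of non-negative functions and maximal functions may take it
(if `ρ` satisfies the axioms below and `ρ f < ∞`, then `f` is finite almost everywhere). -/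
abbrev FunctionNorm (n : ℕ) : Type := (Rn n → ℝ≥0∞) → ℝ≥0∞

/-- The function space of `ρ`: all complex-valued Lebesgue measurable `f` with `ρ |f| < ∞`.
(`AEMeasurable f volume` says that `f` is Lebesgue measurable.) -/
def space {n : ℕ} (ρ : FunctionNorm n) : Set (Rn n → ℂ) :=
  {f | AEMeasurable f volume ∧ ρ (fun x => ‖f x‖ₑ) < ∞}

/-- `ρ` is the quasi-norm of a ball quasi-Banach function space on `ℝⁿ`. -/
structure IsBallQuasiBanach {n : ℕ} (ρ : FunctionNorm n) : Prop where
  /-- The quasi-triangle inequality. -/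
  quasi_add : ∃ K : ℝ≥0, 1 ≤ K ∧ ∀ f g : Rn n → ℝ≥0∞, AEMeasurable f volume →
    AEMeasurable g volume → ρ (fun x => f x + g x) ≤ K * (ρ f + ρ g)
  /-- Homogeneity. -/
  smul : ∀ (c : ℝ≥0) (f : Rn n → ℝ≥0∞), AEMeasurable f volume →
    ρ (fun x => c * f x) = c * ρ f
  /-- Definiteness. -/
  eq_zero : ∀ f : Rn n → ℝ≥0∞, AEMeasurable f volume → ρ f = 0 → ∀ᵐ x, f x = 0
  /-- The lattice property. -/
  mono : ∀ f g : Rn n → ℝ≥0∞, AEMeasurable f volume → AEMeasurable g volume →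
    (∀ᵐ x, g x ≤ f x) → ρ g ≤ ρ f
  /-- The Fatou property: `0 ≤ fₘ ↑ f` almost everywhere implies `‖fₘ‖ ↑ ‖f‖`. -/
  fatou : ∀ (F : ℕ → Rn n → ℝ≥0∞) (f : Rn n → ℝ≥0∞), (∀ m, AEMeasurable (F m) volume) →
    AEMeasurable f volume → (∀ᵐ x, Monotone (fun m => F m x)) →
    (∀ᵐ x, Tendsto (fun m => F m x) atTop (𝓝 (f x))) →
    Tendsto (fun m => ρ (F m)) atTop (𝓝 (ρ f))
  /-- Characteristic functions of balls belong to the space. -/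
  ball_lt_top : ∀ (x : Rn n) (r : ℝ), 0 < r →
    ρ ((Metric.ball x r).indicator (fun _ => 1)) < ∞

/-- `ρ` is the norm of a ball Banach function space on `ℝⁿ`. -/
structure IsBallBanach {n : ℕ} (ρ : FunctionNorm n) : Prop extends IsBallQuasiBanach ρ where
  /-- The triangle inequality. -/
  add : ∀ f g : Rn n → ℝ≥0∞, AEMeasurable f volume → AEMeasurable g volume →
    ρ f < ∞ → ρ g < ∞ → ρ (fun x => f x + g x) ≤ ρ f + ρ g
  /-- Integrability over balls. -/
  ball_lintegral : ∀ (x : Rn n) (r : ℝ), 0 < r → ∃ C : ℝ≥0, 0 < C ∧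
    ∀ f : Rn n → ℝ≥0∞, AEMeasurable f volume → ρ f < ∞ →
      ∫⁻ y in Metric.ball x r, f y ≤ C * ρ f

/-- The power `X^p` of a function space: `‖f‖_{X^p} = ‖ |f|^p ‖_X^{1/p}`, for `p > 0`. -/
def power {n : ℕ} (ρ : FunctionNorm n) (p : ℝ) : FunctionNorm n :=
  fun f => (ρ (fun x => f x ^ p)) ^ (1 / p)

/-- The associate (Köthe dual) norm: `‖f‖_{X'} = sup {‖f g‖_{L¹} : g ∈ X, ‖g‖_X = 1}`. -/
def associate {n : ℕ} (ρ : FunctionNorm n) : FunctionNorm n :=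
  fun f => ⨆ (g : Rn n → ℝ≥0∞) (_ : AEMeasurable g volume) (_ : ρ g = 1), ∫⁻ x, f x * g x

/-- A cube in `ℝⁿ` (with sides parallel to the axes), given by its centre and side length. -/
structure Cube (n : ℕ) where
  center : Rn n
  side : ℝ
  side_pos : 0 < side

/-- The closed cube as a set of points. -/
def Cube.toSet {n : ℕ} (Q : Cube n) : Set (Rn n) :=
  {y | ∀ i, |y i - Q.center i| ≤ Q.side / 2}

/-- The cube `Q*` with the centre of `Q` and side length `100 √n` times that of `Q`. -/
def Cube.star {n : ℕ} (Q : Cube n) : Set (Rn n) :=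
  {y | ∀ i, |y i - Q.center i| ≤ 100 * Real.sqrt n * Q.side / 2}

/-- The Hardy–Littlewood maximal function of (the modulus) `f`:
`M f (x) = sup_{Q ∋ x} |Q|⁻¹ ∫_Q f`. -/
def maximal {n : ℕ} (f : Rn n → ℝ≥0∞) : Rn n → ℝ≥0∞ :=
  fun x => ⨆ (Q : Cube n) (_ : x ∈ Q.toSet), (volume Q.toSet)⁻¹ * ∫⁻ y in Q.toSet, f y

/-- The maximal operator is bounded on the space of `ρ`. -/
def MaximalBounded {n : ℕ} (ρ : FunctionNorm n) : Prop :=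
  ∃ C : ℝ≥0, ∀ f ∈ space ρ, ρ (maximal (fun x => ‖f x‖ₑ)) ≤ C * ρ (fun x => ‖f x‖ₑ)

end BallSpace

end

/-! Write s = α/n, p = p₀, q = q₀, F = ∑ λ_j χ_{Q_j} and G = ∑ λ_j |Q_j|^s χ_{Q_j^*}. The Fatou
property of Y reduces the claim to finite sums. Since ‖G‖_Y^q is the norm of G^q in Y^{1/q}, duality
leaves ∫ G^q g to be bounded for g in the unit ball of (Y^{1/q})'. Only half of the
Lorentz–Luxemburg theorem is needed, and only for a square integrable function, so Hahn–Banach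
separation in L² suffices (`IsBallBanach.le_of_duality`).

The Rubio de Francia algorithm (`exists_weight`) replaces g by an A₁ weight W of comparable norm.
The core is then ∫ G^q W ≤ K (∫ F^p W^{p/q})^{q/p} (`lintegral_rpow_sum_star_le`). Hölder's
inequality for X^{1/p} bounds the right side by ‖F‖_X^q times a power of the norm of W^{p/q} in
(X^{1/p})'. That norm is controlled because an inclusion of these spaces as sets is automatically
bounded (`exists_bound_of_space_subset`).

For the core, each Q_j is replaced by a dyadic cube P_j inside it of comparable size, and Q_j^* by a
dilate E_j of P_j; the cubes are taken in decreasing order of size. On P_j the partial sum up to j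
of ∑ λ_i χ_{P_i} is a constant F_j. As 0 < p < q ≤ 1, telescoping gives (∑ a_j)^q ≤ ∑ a_j S_j^{q-1}
and p ∑ a_j S_j^{p-1} ≤ (∑ a_j)^p, with S_j the partial sums. The first, applied on the E_j, and the
second, on the P_j, are linked cube by cube through the A₁ condition (`lintegral_rpow_sum_le`). -/

namespace BallSpace

/-! ### Power inequalities for partial sums -/

theorem rpow_le_rpow_of_nonpos {x y : ℝ≥0∞} (h : x ≤ y) {z : ℝ} (hz : z ≤ 0) : y ^ z ≤ x ^ z := by
  rw [← neg_neg z, ENNReal.rpow_neg y, ENNReal.rpow_neg x, ENNReal.inv_le_inv]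
  exact ENNReal.rpow_le_rpow h (neg_nonneg.mpr hz)

/-- Write S^q = S · S^(q-1) and lower the last partial sum in the negative power to the previous
one. Finiteness is essential: for S = ∞ the product is ∞ · 0 = 0 when q < 1. -/
theorem rpow_sum_range_le {a : ℕ → ℝ≥0∞} (ha : ∀ i, a i ≠ ∞) {q : ℝ} (hq : 0 < q) (hq1 : q ≤ 1)
    (N : ℕ) : (∑ i ∈ Finset.range N, a i) ^ q ≤
      ∑ j ∈ Finset.range N, a j * (∑ i ∈ Finset.range (j + 1), a i) ^ (q - 1) := by
  have split : ∀ S : ℝ≥0∞, S ≠ ∞ → S ^ q = S * S ^ (q - 1) := fun S hS => by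
    rcases eq_or_ne S 0 with rfl | h0
    · simp [hq]
    · nth_rw 2 [← ENNReal.rpow_one S]
      rw [← ENNReal.rpow_add _ _ h0 hS]; congr 1; ring
  have hfin : ∀ N, ∑ i ∈ Finset.range N, a i ≠ ∞ := fun N =>
    (ENNReal.sum_lt_top.mpr fun i _ => (ha i).lt_top).ne
  induction N with
  | zero => simp [hq]
  | succ N ih =>
    rw [Finset.sum_range_succ (fun j => a j * _)]
    refine le_trans ?_ (add_le_add_left ih _)
    rw [split _ (hfin _), split _ (hfin N)]
    nth_rw 1 [Finset.sum_range_succ]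
    rw [add_mul]
    gcongr ?_ + _
    refine mul_le_mul_right ?_ _
    exact rpow_le_rpow_of_nonpos
      (Finset.sum_le_sum_of_subset (Finset.range_subset_range.mpr N.le_succ)) (by linarith)

/-- Concavity of t ↦ t^p: its graph lies below the tangent at s + a (Bernoulli's inequality). This
is the increment in the induction for `mul_sum_range_le_rpow`. -/
theorem rpow_add_mul_le {s a p : ℝ} (hs : 0 ≤ s) (ha : 0 ≤ a) (hT : 0 < s + a) (hp : 0 ≤ p)
    (hp1 : p ≤ 1) : s ^ p + p * (a * (s + a) ^ (p - 1)) ≤ (s + a) ^ p := by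
  have h1 : (1 + -(a / (s + a))) ^ p ≤ 1 + p * -(a / (s + a)) :=
    rpow_one_add_le_one_add_mul_self
      (by rw [neg_le_neg_iff, div_le_one hT]; linarith) hp hp1
  have h2 : 1 + -(a / (s + a)) = s / (s + a) := by field_simp; ring
  rw [h2, Real.div_rpow hs hT.le, div_le_iff₀ (Real.rpow_pos_of_pos hT p)] at h1
  rw [Real.rpow_sub hT, Real.rpow_one]
  refine (add_le_add_left h1 _).trans (le_of_eq ?_)
  field_simp
  ring

theorem mul_sum_range_le_rpow {a : ℕ → ℝ≥0∞} (ha : ∀ i, a i ≠ ∞) {p : ℝ} (hp : 0 < p)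
    (hp1 : p ≤ 1) (N : ℕ) :
    ENNReal.ofReal p * ∑ j ∈ Finset.range N, a j * (∑ i ∈ Finset.range (j + 1), a i) ^ (p - 1) ≤
      (∑ i ∈ Finset.range N, a i) ^ p := by
  have hfin : ∀ N, ∑ i ∈ Finset.range N, a i ≠ ∞ := fun N =>
    (ENNReal.sum_lt_top.mpr fun i _ => (ha i).lt_top).ne
  induction N with
  | zero => simp
  | succ N ih =>
    rw [Finset.sum_range_succ (fun j => a j * _), mul_add]
    refine (add_le_add_left ih _).trans ?_
    rw [Finset.sum_range_succ]
    generalize hS : ∑ i ∈ Finset.range N, a i = S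
    have hS' : S ≠ ∞ := hS ▸ hfin N
    rcases eq_or_ne (S + a N) 0 with h0 | h0
    · rw [add_eq_zero] at h0
      simp [h0.1, h0.2, hp]
    · lift S to ℝ≥0 using hS'
      obtain ⟨b, hb⟩ := WithTop.ne_top_iff_exists.mp (ha N)
      change (b : ℝ≥0∞) = _ at hb
      rw [← hb] at h0 ⊢
      rw [← ENNReal.coe_add] at h0 ⊢
      have h0' : S + b ≠ 0 := by exact_mod_cast h0
      rw [← ENNReal.coe_rpow_of_ne_zero h0', ← ENNReal.coe_rpow_of_ne_zero h0',
        ← ENNReal.coe_rpow_of_nonneg _ hp.le, ENNReal.ofReal]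
      norm_cast
      rw [← NNReal.coe_le_coe]
      push_cast
      rw [Real.coe_toNNReal _ hp.le]
      exact rpow_add_mul_le S.2 b.2 (by exact_mod_cast pos_iff_ne_zero.mpr h0') hp.le hp1

/-! ### The A₁-weighted inequality for nested sets -/

section Weighted

variable {Ω : Type*} [MeasurableSpace Ω] {μ : Measure Ω}

/-- The A₁ bound says that W is at least (C v)⁻¹ ∫_E W everywhere on P. Integrating the power p/q
over P and raising to q/p gives the claim, the exponent relation turning v^(q/p) into v · v^(s q).
-/
theorem rpow_mul_setLIntegral_le {P E : Set Ω} (hP : MeasurableSet P) {W : Ω → ℝ≥0∞}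
    {C v : ℝ≥0∞} (hC : C ≠ 0) (hC' : C ≠ ∞) (hv : v ≠ 0) (hv' : v ≠ ∞) (hvP : v ≤ μ P)
    (hW : ∀ x ∈ P, ∫⁻ y in E, W y ∂μ ≤ C * v * W x) {p q s : ℝ} (hp : 0 < p) (hq : 0 < q)
    (hexp : q / p = 1 + s * q) :
    v ^ (s * q) * ∫⁻ y in E, W y ∂μ ≤ C * (∫⁻ y in P, W y ^ (p / q) ∂μ) ^ (q / p) := by
  set I := ∫⁻ y in E, W y ∂μ
  have h0 : C * v ≠ 0 := mul_ne_zero hC hv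
  have ht : C * v ≠ ∞ := ENNReal.mul_ne_top hC' hv'
  have h1 : v * ((C * v)⁻¹ * I) ^ (p / q) ≤ ∫⁻ y in P, W y ^ (p / q) ∂μ := by
    calc v * ((C * v)⁻¹ * I) ^ (p / q) ≤ ((C * v)⁻¹ * I) ^ (p / q) * μ P := by
          rw [mul_comm]; gcongr
      _ = ∫⁻ _ in P, ((C * v)⁻¹ * I) ^ (p / q) ∂μ := (setLIntegral_const _ _).symm
      _ ≤ _ := by
          refine setLIntegral_mono' hP fun x hx => ?_
          refine ENNReal.rpow_le_rpow ?_ (by positivity)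
          rw [ENNReal.inv_mul_le_iff h0 ht]
          exact hW x hx
  have h2 := ENNReal.rpow_le_rpow h1 (show 0 ≤ q / p by positivity)
  rw [ENNReal.mul_rpow_of_nonneg _ _ (by positivity), ← ENNReal.rpow_mul,
    show p / q * (q / p) = 1 by field_simp, ENNReal.rpow_one, hexp,
    ENNReal.rpow_add _ _ hv hv', ENNReal.rpow_one] at h2
  rw [hexp]
  refine le_trans (le_of_eq ?_) (mul_le_mul_right h2 C)
  calc v ^ (s * q) * I = v ^ (s * q) * ((C * v) * (C * v)⁻¹ * I) := by
        rw [ENNReal.mul_inv_cancel h0 ht, one_mul]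
    _ = _ := by ring

/-- A weighted fractional inequality for a nested family of sets. -/
theorem lintegral_rpow_sum_le {P E : ℕ → Set Ω} (hP : ∀ j, MeasurableSet (P j))
    (hE : ∀ j, MeasurableSet (E j)) {W : Ω → ℝ≥0∞}
    (hWm : AEMeasurable W μ) {C : ℝ≥0∞} (hC : C ≠ 0) (hC' : C ≠ ∞) {v l : ℕ → ℝ≥0∞}
    (hv : ∀ j, v j ≠ 0) (hv' : ∀ j, v j ≠ ∞) (hl : ∀ j, l j ≠ 0) (hl' : ∀ j, l j ≠ ∞)
    (hvP : ∀ j, v j ≤ μ (P j)) {N : ℕ} (hanti : ∀ i j, i ≤ j → j < N → v j ≤ v i)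
    (hnest : ∀ i j, i ≤ j → j < N → ∀ x ∈ P i, x ∈ P j → P j ⊆ P i)
    (hEsub : ∀ i j, i ≤ j → j < N → P j ⊆ P i → E j ⊆ E i)
    (hW : ∀ j, ∀ x ∈ P j, ∫⁻ y in E j, W y ∂μ ≤ C * v j * W x) {p q s : ℝ} (hp : 0 < p)
    (hpq : p < q) (hq1 : q ≤ 1) (hs : 0 ≤ s) (hexp : q / p = 1 + s * q) :
    ∫⁻ x, (∑ j ∈ Finset.range N, (E j).indicator (fun _ => l j * v j ^ s) x) ^ q * W x ∂μ ≤
      C * (ENNReal.ofReal p)⁻¹ *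
        (∫⁻ x, (∑ j ∈ Finset.range N, (P j).indicator (fun _ => l j) x) ^ p * W x ^ (p / q) ∂μ) ^
          (q / p) := by
  classical
  have hq : 0 < q := hp.trans hpq
  set I := ∫⁻ x, (∑ j ∈ Finset.range N, (P j).indicator (fun _ => l j) x) ^ p *
    W x ^ (p / q) ∂μ with hI
  -- By nesting, for j < N, this is the constant value on `P j` of the partial sum up to j. The term
  -- i = j makes it nonzero, so negative powers of it are finite.
  set F : ℕ → ℝ≥0∞ := fun j => ∑ i ∈ Finset.range (j + 1), if P j ⊆ P i then l i else 0 with hF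
  have hF0 : ∀ j, F j ≠ 0 := fun j h => by
    rw [hF, Finset.sum_eq_zero_iff] at h
    simpa [hl j] using h j (by simp)
  have hFt : ∀ j, F j ≠ ∞ := fun j => (ENNReal.sum_lt_top.mpr fun i _ => by
    split_ifs
    · exact (hl' i).lt_top
    · exact ENNReal.zero_lt_top).ne
  have hFeq : ∀ j < N, ∀ x ∈ P j,
      ∑ i ∈ Finset.range (j + 1), (P i).indicator (fun _ => l i) x = F j := fun j hj x hx => by
    refine Finset.sum_congr rfl fun i hi => ?_
    have hij : i ≤ j := Nat.lt_succ_iff.mp (Finset.mem_range.mp hi)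
    by_cases h : P j ⊆ P i
    · simp [h, h hx]
    · have : x ∉ P i := fun hxi => h (hnest i j hij hj x hxi hx)
      simp [h, this]
  have hVm : AEMeasurable (fun x => W x ^ (p / q)) μ := hWm.pow_const _
  set u : ℕ → ℝ≥0∞ := fun j => ∫⁻ y in P j, W y ^ (p / q) ∂μ with hu
  have hupper : ∀ x, (∑ j ∈ Finset.range N, (E j).indicator (fun _ => l j * v j ^ s) x) ^ q ≤
      ∑ j ∈ Finset.range N, (E j).indicator (fun _ => l j * F j ^ (q - 1) * v j ^ (s * q)) x := by
    intro x
    have hvs : ∀ j, v j ^ s ≠ ∞ := fun j => ENNReal.rpow_ne_top_of_nonneg hs (hv' j)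
    refine (rpow_sum_range_le (fun i => ?_) hq hq1 N).trans (Finset.sum_le_sum fun j hj => ?_)
    · by_cases h : x ∈ E i
      · simp only [Set.indicator_of_mem h]
        exact ENNReal.mul_ne_top (hl' i) (hvs i)
      · simp [h]
    · by_cases h : x ∈ E j
      · simp only [Set.indicator_of_mem h]
        -- Each `P i` counted in `F j` has `E i` containing `E j` and `v i ≥ v j`, so it contributes
        -- at least `l i * v j ^ s` at x. The exponent q - 1 ≤ 0 reverses this bound.
        have hlow : v j ^ s * F j ≤
            ∑ i ∈ Finset.range (j + 1), (E i).indicator (fun _ => l i * v i ^ s) x := by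
          rw [hF, Finset.mul_sum]
          refine Finset.sum_le_sum fun i hi => ?_
          have hij : i ≤ j := Nat.lt_succ_iff.mp (Finset.mem_range.mp hi)
          by_cases hs' : P j ⊆ P i
          · simp only [hs', if_true, Set.indicator_of_mem (hEsub i j hij (Finset.mem_range.mp hj) hs' h)]
            rw [mul_comm]
            gcongr
            exact hanti i j hij (Finset.mem_range.mp hj)
          · simp [hs']
        calc _ ≤ l j * v j ^ s * (v j ^ s * F j) ^ (q - 1) := by
              exact mul_le_mul_right (rpow_le_rpow_of_nonpos hlow (by linarith)) _
          _ = _ := by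
              rw [ENNReal.mul_rpow_of_ne_top (hvs j) (hFt j), ← ENNReal.rpow_mul,
                show s * q = s + s * (q - 1) by ring, ENNReal.rpow_add _ _ (hv j) (hv' j)]
              ring
      · simp [h]
  have hlower : ∀ x, ENNReal.ofReal p *
      ∑ j ∈ Finset.range N, (P j).indicator (fun _ => l j * F j ^ (p - 1)) x ≤
      (∑ j ∈ Finset.range N, (P j).indicator (fun _ => l j) x) ^ p := by
    intro x
    refine le_trans (le_of_eq ?_) (mul_sum_range_le_rpow
      (a := fun j => (P j).indicator (fun _ => l j) x) (fun i => ?_) hp (hpq.le.trans hq1) N)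
    · congr 1
      refine Finset.sum_congr rfl fun j hj => ?_
      by_cases h : x ∈ P j
      · rw [hFeq j (Finset.mem_range.mp hj) x h]; simp [h]
      · simp [h]
    · by_cases h : x ∈ P i <;> simp [h, hl' i]
  -- On `P j` the full sum dominates its partial sum `F j`.
  have hFu : ∀ j ∈ Finset.range N, F j ^ p * u j ≤ I := fun j hj => by
    rw [hu, ← lintegral_const_mul'' _ hVm.restrict]
    refine le_trans ?_ (setLIntegral_le_lintegral (P j) _)
    refine setLIntegral_mono' (hP j) fun x hx => ?_
    refine mul_le_mul_left (ENNReal.rpow_le_rpow ?_ hp.le) _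
    rw [← hFeq j (Finset.mem_range.mp hj) x hx]
    exact Finset.sum_le_sum_of_subset (Finset.range_subset_range.mpr (Finset.mem_range.mp hj))
  have hsum : ENNReal.ofReal p * ∑ j ∈ Finset.range N, l j * F j ^ (p - 1) * u j ≤ I := by
    have : ∑ j ∈ Finset.range N, l j * F j ^ (p - 1) * u j =
        ∫⁻ x, (∑ j ∈ Finset.range N, (P j).indicator (fun _ => l j * F j ^ (p - 1)) x) *
          W x ^ (p / q) ∂μ := by
      simp_rw [Finset.sum_mul]
      rw [lintegral_finsetSum' (f := fun j x => (P j).indicator (fun _ => l j * F j ^ (p - 1)) x *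
        W x ^ (p / q)) _ fun j _ => (aemeasurable_const.indicator (hP j)).mul hVm]
      refine Finset.sum_congr rfl fun j _ => ?_
      rw [hu, ← lintegral_const_mul'' _ hVm.restrict, ← lintegral_indicator (hP j)]
      refine lintegral_congr fun x => ?_
      by_cases h : x ∈ P j <;> simp [h]
    rw [this, ← lintegral_const_mul' _ _ ENNReal.ofReal_ne_top]
    refine lintegral_mono fun x => ?_
    rw [← mul_assoc]
    exact mul_le_mul_left (hlower x) _
  have hp0 : ENNReal.ofReal p ≠ 0 := by simpa using hp
  calc _ ≤ ∫⁻ x, ∑ j ∈ Finset.range N,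
        (E j).indicator (fun _ => l j * F j ^ (q - 1) * v j ^ (s * q)) x * W x ∂μ := by
        refine lintegral_mono fun x => ?_
        rw [← Finset.sum_mul]
        exact mul_le_mul_left (hupper x) _
    _ = ∑ j ∈ Finset.range N, l j * F j ^ (q - 1) * (v j ^ (s * q) * ∫⁻ y in E j, W y ∂μ) := by
        rw [lintegral_finsetSum' (f := fun j x => (E j).indicator
          (fun _ => l j * F j ^ (q - 1) * v j ^ (s * q)) x * W x) _
          fun j _ => (aemeasurable_const.indicator (hE j)).mul hWm]
        refine Finset.sum_congr rfl fun j _ => ?_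
        rw [← mul_assoc, ← lintegral_const_mul'' _ hWm.restrict, ← lintegral_indicator (hE j)]
        refine lintegral_congr fun x => ?_
        by_cases h : x ∈ E j <;> simp [h]
    _ ≤ ∑ j ∈ Finset.range N, C * I ^ ((q - p) / p) * (l j * F j ^ (p - 1) * u j) := by
        refine Finset.sum_le_sum fun j hj => ?_
        calc _ ≤ l j * F j ^ (q - 1) * (C * u j ^ (q / p)) :=
              mul_le_mul_right (rpow_mul_setLIntegral_le (hP j) hC hC' (hv j) (hv' j) (hvP j)
                (hW j) hp hq hexp) _
          -- This splitting isolates a factor bounded by a power of I through `hFu`; what remains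
          -- sums to at most I / p by `hsum`.
          _ = C * (F j ^ p * u j) ^ ((q - p) / p) * (l j * F j ^ (p - 1) * u j) := by
              have e0 : 0 ≤ (q - p) / p := div_nonneg (by linarith) hp.le
              rw [ENNReal.mul_rpow_of_nonneg _ _ e0, ← ENNReal.rpow_mul,
                show p * ((q - p) / p) = q - p by field_simp,
                show q / p = (q - p) / p + 1 by field_simp; ring,
                ENNReal.rpow_add_of_nonneg _ _ e0 zero_le_one, ENNReal.rpow_one,
                show q - 1 = (q - p) + (p - 1) by ring, ENNReal.rpow_add _ _ (hF0 j) (hFt j)]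
              ring
          _ ≤ _ := by
              refine mul_le_mul_left (mul_le_mul_right (ENNReal.rpow_le_rpow (hFu j hj) ?_) _) _
              exact div_nonneg (by linarith) hp.le
    _ = C * I ^ ((q - p) / p) * ∑ j ∈ Finset.range N, l j * F j ^ (p - 1) * u j := by
        rw [Finset.mul_sum]
    _ ≤ C * I ^ ((q - p) / p) * ((ENNReal.ofReal p)⁻¹ * I) := by
        refine mul_le_mul_right ?_ _
        rwa [← ENNReal.div_eq_inv_mul, ENNReal.le_div_iff_mul_le (Or.inl hp0)
          (Or.inl ENNReal.ofReal_ne_top), mul_comm]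
    _ = _ := by
        have e0 : 0 ≤ (q - p) / p := div_nonneg (by linarith) hp.le
        rw [show q / p = (q - p) / p + 1 by field_simp; ring,
          ENNReal.rpow_add_of_nonneg _ _ e0 zero_le_one, ENNReal.rpow_one]
        ring

end Weighted

/-! ### Associate norms and Hölder's inequality -/

section FunctionNorms

variable {n : ℕ} {ρ : FunctionNorm n}

theorem IsBallQuasiBanach.congr (hρ : IsBallQuasiBanach ρ) {f g : Rn n → ℝ≥0∞}
    (hf : AEMeasurable f volume) (hg : AEMeasurable g volume) (h : ∀ᵐ x, f x = g x) :
    ρ f = ρ g :=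
  le_antisymm (hρ.mono g f hg hf (h.mono fun _ hx => hx.le))
    (hρ.mono f g hf hg (h.mono fun _ hx => hx.ge))

theorem associate_mono {f g : Rn n → ℝ≥0∞} (h : ∀ᵐ x, f x ≤ g x) :
    associate ρ f ≤ associate ρ g :=
  iSup_mono fun _ => iSup_mono fun _ => iSup_mono fun _ =>
    lintegral_mono_ae (h.mono fun _ hx => mul_le_mul_left hx _)

theorem associate_tsum_le {F : ℕ → Rn n → ℝ≥0∞} (hF : ∀ k, AEMeasurable (F k) volume) :
    associate ρ (fun x => ∑' k, F k x) ≤ ∑' k, associate ρ (F k) := by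
  refine iSup_le fun g => iSup_le fun hg => iSup_le fun h1 => ?_
  simp_rw [← ENNReal.tsum_mul_right]
  rw [lintegral_tsum (f := fun k x => F k x * g x) fun k => (hF k).mul hg]
  exact ENNReal.tsum_le_tsum fun k => le_iSup_of_le g (le_iSup_of_le hg (le_iSup_of_le h1 le_rfl))

theorem associate_const_mul (c : ℝ≥0) (f : Rn n → ℝ≥0∞) :
    associate ρ (fun x => c * f x) = c * associate ρ f := by
  simp only [associate, ENNReal.mul_iSup, mul_assoc]
  simp_rw [lintegral_const_mul' (c : ℝ≥0∞) _ ENNReal.coe_ne_top]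

/-- Hölder's inequality for a norm and its associate norm. -/
theorem IsBallQuasiBanach.lintegral_mul_le (hρ : IsBallQuasiBanach ρ) {f g : Rn n → ℝ≥0∞}
    (hf : AEMeasurable f volume) (hfin : ρ f < ∞) :
    ∫⁻ x, f x * g x ≤ ρ f * associate ρ g := by
  -- The associate norm tests only functions of norm exactly 1, so a function of norm zero cannot be
  -- normalised and is treated by definiteness.
  rcases eq_or_ne (ρ f) 0 with h0 | h0
  · have : ∀ᵐ x, f x * g x = 0 := (hρ.eq_zero f hf h0).mono fun x hx => by rw [hx, zero_mul]
    rw [lintegral_congr_ae this]; simp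
  · obtain ⟨c, hc⟩ := WithTop.ne_top_iff_exists.mp hfin.ne
    change (c : ℝ≥0∞) = _ at hc
    have hc0 : c ≠ 0 := by rintro rfl; exact h0 (by rw [← hc]; rfl)
    have h1 : ρ (fun x => (c⁻¹ : ℝ≥0) * f x) = 1 := by
      rw [hρ.smul _ _ hf, ← hc, ← ENNReal.coe_mul, inv_mul_cancel₀ hc0, ENNReal.coe_one]
    have h2 : ∫⁻ x, g x * ((c⁻¹ : ℝ≥0) * f x) ≤ associate ρ g :=
      le_iSup_of_le _ (le_iSup_of_le (hf.const_mul _) (le_iSup_of_le h1 le_rfl))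
    have h3 : ∀ x, f x * g x = c * (g x * ((c⁻¹ : ℝ≥0) * f x)) := fun x => by
      rw [mul_left_comm (g x), ← mul_assoc, ← ENNReal.coe_mul, mul_inv_cancel₀ hc0,
        ENNReal.coe_one, one_mul, mul_comm]
    simp_rw [h3]
    rw [lintegral_const_mul' _ _ ENNReal.coe_ne_top, ← hc]
    gcongr

/-- Hölder's inequality against indicators of balls makes g locally integrable. This allows passage
between `[0, ∞]`-valued functions and the complex-valued members of `space`. -/
theorem IsBallQuasiBanach.ae_lt_top_of_associate (hρ : IsBallQuasiBanach ρ) {g : Rn n → ℝ≥0∞}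
    (hg : AEMeasurable g volume) (h : associate ρ g < ∞) : ∀ᵐ x, g x < ∞ := by
  have key : ∀ N : ℕ, ∀ᵐ x, x ∈ Metric.ball (0 : Rn n) (N + 1) → g x < ∞ := fun N => by
    have hm : MeasurableSet (Metric.ball (0 : Rn n) (N + 1)) := measurableSet_ball
    have hi : Measurable ((Metric.ball (0 : Rn n) (N + 1)).indicator fun _ => (1 : ℝ≥0∞)) :=
      measurable_const.indicator hm
    have hb := hρ.ball_lt_top 0 (N + 1) (by positivity)
    have h2 := hρ.lintegral_mul_le (g := g) hi.aemeasurable hb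
    have h3 : ∫⁻ x in Metric.ball (0 : Rn n) (N + 1), g x < ∞ := by
      rw [← lintegral_indicator hm]
      refine lt_of_le_of_lt (le_of_eq (lintegral_congr fun x => ?_))
        (h2.trans_lt (ENNReal.mul_lt_top hb h))
      by_cases hx : x ∈ Metric.ball (0 : Rn n) (N + 1) <;> simp [Set.indicator, hx]
    rw [← ae_restrict_iff' hm]
    exact ae_lt_top' hg.restrict h3.ne
  filter_upwards [ae_all_iff.mpr key] with x hx
  obtain ⟨N, hN⟩ := exists_nat_gt ‖x‖
  exact hx N (by simp; linarith)

theorem enorm_toReal {a : ℝ≥0∞} (h : a < ∞) : ‖((a.toReal : ℝ) : ℂ)‖ₑ = a := by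
  rw [← ofReal_norm]
  simp [h.ne]

/-! ### Duality through L², and automatic boundedness of inclusions -/

/-- The infima over tails increase to f and each lies below a function of the unit ball, so the
Fatou property applies. -/
theorem IsBallQuasiBanach.seq_closed (hρ : IsBallQuasiBanach ρ) {h : ℕ → Rn n → ℝ≥0∞}
    {f : Rn n → ℝ≥0∞} (hm : ∀ k, AEMeasurable (h k) volume) (hf : AEMeasurable f volume)
    (hlim : ∀ᵐ x, Tendsto (fun k => h k x) atTop (𝓝 (f x))) (h1 : ∀ k, ρ (h k) ≤ 1) :
    ρ f ≤ 1 := by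
  have hinf : ∀ m, AEMeasurable (fun x => ⨅ k, h (m + k) x) volume := fun m =>
    AEMeasurable.iInf fun k => hm _
  refine le_of_tendsto' (hρ.fatou (fun m x => ⨅ k, h (m + k) x) f hinf hf ?_ ?_) fun m => ?_
  · refine Eventually.of_forall fun x => monotone_nat_of_le_succ fun m => le_iInf fun k => ?_
    exact (iInf_le _ (k + 1)).trans (by rw [show m + (k + 1) = m + 1 + k by ring])
  · filter_upwards [hlim] with x hx
    have h2 := hx.liminf_eq
    rw [liminf_eq_iSup_iInf_of_nat'] at h2
    rw [← h2]
    have := tendsto_atTop_iSup (f := fun m => ⨅ k, h (m + k) x) <|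
      monotone_nat_of_le_succ fun m => le_iInf fun k =>
        (iInf_le _ (k + 1)).trans (by rw [show m + (k + 1) = m + 1 + k by ring])
    simpa only [add_comm] using this
  · exact (hρ.mono (h m) _ (hm m) (hinf m)
      (Eventually.of_forall fun x => iInf_le (fun k => h (m + k) x) 0)).trans (h1 m)

/-- The unit ball of `ρ` inside `L²`. -/
def unitBall (ρ : FunctionNorm n) : Set (Lp ℝ 2 (volume : Measure (Rn n))) :=
  {h | ρ (fun x => ‖h x‖ₑ) ≤ 1}

theorem IsBallBanach.convex_unitBall (hρ : IsBallBanach ρ) : Convex ℝ (unitBall ρ) := by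
  intro f hf g hg a b ha hb hab
  have mf : AEMeasurable (fun x => ‖f x‖ₑ) volume := (Lp.aestronglyMeasurable f).enorm
  have mg : AEMeasurable (fun x => ‖g x‖ₑ) volume := (Lp.aestronglyMeasurable g).enorm
  have e : ∀ᵐ x, ‖(a • f + b • g : Lp ℝ 2 (volume : Measure (Rn n))) x‖ₑ ≤
      a.toNNReal * ‖f x‖ₑ + b.toNNReal * ‖g x‖ₑ := by
    filter_upwards [Lp.coeFn_add (a • f) (b • g), Lp.coeFn_smul a f, Lp.coeFn_smul b g]
      with x h1 h2 h3
    rw [h1, Pi.add_apply, h2, h3, Pi.smul_apply, Pi.smul_apply]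
    refine (enorm_add_le _ _).trans (le_of_eq ?_)
    rw [smul_eq_mul, smul_eq_mul, enorm_mul, enorm_mul, Real.enorm_of_nonneg ha,
      Real.enorm_of_nonneg hb]
    rfl
  have h1 : ρ (fun x => a.toNNReal * ‖f x‖ₑ) ≤ a.toNNReal := by
    rw [hρ.smul _ _ mf]; exact mul_le_of_le_one_right' hf
  have h2 : ρ (fun x => b.toNNReal * ‖g x‖ₑ) ≤ b.toNNReal := by
    rw [hρ.smul _ _ mg]; exact mul_le_of_le_one_right' hg
  calc ρ (fun x => ‖(a • f + b • g : Lp ℝ 2 (volume : Measure (Rn n))) x‖ₑ)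
      ≤ ρ (fun x => a.toNNReal * ‖f x‖ₑ + b.toNNReal * ‖g x‖ₑ) :=
        hρ.mono _ _ ((mf.const_mul _).add (mg.const_mul _)) (Lp.aestronglyMeasurable _).enorm e
    _ ≤ a.toNNReal + b.toNNReal := (hρ.add _ _ (mf.const_mul _) (mg.const_mul _)
        (h1.trans_lt ENNReal.coe_lt_top) (h2.trans_lt ENNReal.coe_lt_top)).trans
        (add_le_add h1 h2)
    _ = 1 := by
        rw [← ENNReal.coe_add, ← Real.toNNReal_add ha hb, hab]; simp

theorem IsBallQuasiBanach.isClosed_unitBall (hρ : IsBallQuasiBanach ρ) :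
    IsClosed (unitBall ρ) := by
  refine IsSeqClosed.isClosed fun h f hh hlim => ?_
  obtain ⟨φ, -, hφ⟩ := (tendstoInMeasure_of_tendsto_Lp hlim).exists_seq_tendsto_ae
  exact hρ.seq_closed (fun k => (Lp.aestronglyMeasurable (h (φ k))).enorm)
    (Lp.aestronglyMeasurable f).enorm
    (hφ.mono fun x hx => (continuous_enorm.tendsto _).comp hx) fun k => hh (φ k)


theorem IsBallQuasiBanach.lintegral_le_of_unitBall (hρ : IsBallQuasiBanach ρ)
    {φ : Lp ℝ 2 (volume : Measure (Rn n)) →L[ℝ] ℝ} {u : ℝ} (hφ : ∀ h ∈ unitBall ρ, φ h < u)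
    {g : Lp ℝ 2 (volume : Measure (Rn n))} (hg : ∀ h, φ h = ∫ x, g x * h x)
    {h : Rn n → ℝ≥0∞} (hh : AEMeasurable h volume) (h1 : ρ h ≤ 1) :
    ∫⁻ x, ‖g x‖ₑ * h x ≤ ENNReal.ofReal u := by
  -- A test function need not be in L², where the functional acts. Truncating height and support
  -- puts it there; monotone convergence recovers h.
  set T : ℕ → Rn n → ℝ≥0∞ := fun m => (Metric.ball (0 : Rn n) m).indicator
    fun x => min (h x) m with hT
  have hTm : ∀ m, AEMeasurable (T m) volume := fun m =>
    (hh.min aemeasurable_const).indicator measurableSet_ball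
  have hTle : ∀ m x, T m x ≤ h x := fun m x => by
    by_cases hx : x ∈ Metric.ball (0 : Rn n) m <;> simp [hT, hx]
  have hTlt : ∀ m x, T m x ≤ (Metric.ball (0 : Rn n) m).indicator (fun _ => (m : ℝ≥0∞)) x :=
    fun m x => by by_cases hx : x ∈ Metric.ball (0 : Rn n) m <;> simp [hT, hx]
  have hTtop : ∀ m x, T m x ≠ ∞ := fun m x => by
    refine ne_top_of_le_ne_top ?_ (hTlt m x)
    by_cases hx : x ∈ Metric.ball (0 : Rn n) m <;> simp [hx]
  have hgm : AEMeasurable g volume := (Lp.aestronglyMeasurable g).aemeasurable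
  have hmono : ∀ x, Monotone fun m => T m x := fun x a b hab => by
    have hab' : (a : ℝ≥0∞) ≤ b := by exact_mod_cast hab
    by_cases hx : x ∈ Metric.ball (0 : Rn n) a
    · have hx' : x ∈ Metric.ball (0 : Rn n) b :=
        Metric.ball_subset_ball (by exact_mod_cast hab) hx
      simp only [hT, Set.indicator_of_mem hx, Set.indicator_of_mem hx']
      exact min_le_min_left _ hab'
    · simp [hT, Set.indicator_of_notMem hx]
  have hlim : ∀ x, Tendsto (fun m => T m x) atTop (𝓝 (h x)) := fun x => by
    obtain ⟨N, hN⟩ := exists_nat_gt ‖x‖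
    have : Tendsto (fun m : ℕ => min (h x) (m : ℝ≥0∞)) atTop (𝓝 (min (h x) ∞)) :=
      tendsto_const_nhds.min ENNReal.tendsto_nat_nhds_top
    rw [min_eq_left le_top] at this
    refine this.congr' ?_
    filter_upwards [eventually_ge_atTop N] with m hm
    have : x ∈ Metric.ball (0 : Rn n) m := by
      simp only [Metric.mem_ball, dist_zero_right]
      exact hN.trans_le (by exact_mod_cast hm)
    simp [hT, this]
  refine le_of_tendsto' (lintegral_tendsto_of_tendsto_of_monotone
    (F := fun x => ‖g x‖ₑ * h x) (f := fun m x => ‖g x‖ₑ * T m x)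
    (fun m => hgm.enorm.mul (hTm m)) (Eventually.of_forall fun x a b hab => by
      exact mul_le_mul_right (hmono x hab) _)
    (Eventually.of_forall fun x => ENNReal.Tendsto.const_mul (hlim x)
      (Or.inr enorm_ne_top))) fun m => ?_
  -- Multiplying by the sign of g turns the pairing into the integral of |g| times the truncation
  -- without changing the modulus of the test function.
  set sg : ℝ → ℝ := fun t => if 0 ≤ t then 1 else -1 with hsg
  have hsg1 : ∀ t, |sg t| = 1 := fun t => by by_cases ht : 0 ≤ t <;> simp [hsg, ht]
  have hsgm : Measurable sg := Measurable.ite measurableSet_Ici measurable_const measurable_const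
  have hsgt : ∀ t, t * sg t = |t| := fun t => by
    by_cases ht : 0 ≤ t
    · simp [hsg, ht, abs_of_nonneg]
    · simp [hsg, ht, abs_of_neg (not_le.mp ht)]
  have hk : MemLp (fun x => sg (g x) * (T m x).toReal) 2 volume := by
    refine MemLp.mono (memLp_indicator_const 2 (measurableSet_ball (x := (0 : Rn n)) (ε := m))
      (m : ℝ) (Or.inr measure_ball_lt_top.ne)) ?_ (Eventually.of_forall fun x => ?_)
    · exact ((hsgm.comp_aemeasurable hgm).mul (hTm m).ennreal_toReal).aestronglyMeasurable
    · rw [norm_mul, Real.norm_eq_abs, hsg1, one_mul, Real.norm_of_nonneg ENNReal.toReal_nonneg]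
      refine (ENNReal.toReal_mono ?_ (hTlt m x)).trans ?_ <;>
        by_cases hx : x ∈ Metric.ball (0 : Rn n) m <;> simp [hx]
  have hks : hk.toLp _ ∈ unitBall ρ := by
    refine (hρ.mono h _ hh (Lp.aestronglyMeasurable _).enorm ?_).trans h1
    filter_upwards [hk.coeFn_toLp] with x hx
    rw [hx, enorm_mul, Real.enorm_eq_ofReal_abs, hsg1, ENNReal.ofReal_one, one_mul,
      Real.enorm_of_nonneg ENNReal.toReal_nonneg, ENNReal.ofReal_toReal (hTtop m x)]
    exact hTle m x
  have h3 : ∫ x, g x * hk.toLp _ x = ∫ x, |g x| * (T m x).toReal := by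
    refine integral_congr_ae ?_
    filter_upwards [hk.coeFn_toLp] with x hx
    rw [hx, ← mul_assoc, hsgt]
  have h4 := hφ _ hks
  rw [hg, h3] at h4
  have h5 : Integrable (fun x => |g x| * (T m x).toReal) volume := by
    refine (L2.integrable_inner (𝕜 := ℝ) g (hk.toLp _)).congr ?_
    filter_upwards [hk.coeFn_toLp] with x hx
    rw [hx, ← hsgt]
    simp only [Real.inner_apply]
    ring
  refine le_trans (le_of_eq ?_) (ENNReal.ofReal_le_ofReal h4.le)
  rw [ofReal_integral_eq_lintegral_ofReal h5 (Eventually.of_forall fun x => by positivity)]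
  refine lintegral_congr fun x => ?_
  rw [ENNReal.ofReal_mul (abs_nonneg _), ENNReal.ofReal_toReal (hTtop m x), Real.enorm_eq_ofReal_abs]

/-- One half of the Lorentz–Luxemburg theorem, for square integrable functions. -/
theorem IsBallBanach.le_one_of_duality (hρ : IsBallBanach ρ) {f : Rn n → ℝ≥0∞}
    (hf : AEMeasurable f volume) (hfin : ∀ x, f x ≠ ∞)
    (h2 : MemLp (fun x => (f x).toReal) 2 volume)
    (hd : ∀ g : Rn n → ℝ≥0∞, AEMeasurable g volume → associate ρ g ≤ 1 → ∫⁻ x, f x * g x ≤ 1) :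
    ρ f ≤ 1 := by
  by_contra hcon
  have hfx : ∀ x, ‖(f x).toReal‖ₑ = f x := fun x => by
    rw [Real.enorm_of_nonneg ENNReal.toReal_nonneg, ENNReal.ofReal_toReal (hfin x)]
  have hnot : h2.toLp _ ∉ unitBall ρ := fun hmem => hcon <| by
    refine le_trans (le_of_eq (hρ.congr hf (Lp.aestronglyMeasurable _).enorm ?_)) hmem
    filter_upwards [h2.coeFn_toLp] with x hx
    rw [hx, hfx]
  -- If f lay outside the closed convex unit ball, a functional would separate it. Its Riesz
  -- representative g, divided by u, is admissible in the duality hypothesis, which forces φ f ≤ u.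
  obtain ⟨φ, u, hφ, hu⟩ := geometric_hahn_banach_closed_point hρ.convex_unitBall
    hρ.isClosed_unitBall hnot
  set g := (InnerProductSpace.toDual ℝ (Lp ℝ 2 (volume : Measure (Rn n)))).symm φ
  have hg : ∀ h, φ h = ∫ x, g x * h x := fun h => by
    rw [← InnerProductSpace.toDual_symm_apply, L2.inner_def]
    refine integral_congr_ae (Eventually.of_forall fun x => ?_)
    simp [g, mul_comm]
  have hgm : AEMeasurable g volume := (Lp.aestronglyMeasurable g).aemeasurable
  have hu0 : 0 < u := by
    have : (0 : Lp ℝ 2 (volume : Measure (Rn n))) ∈ unitBall ρ := by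
      have h0 : ρ (fun _ => 0) = 0 := by
        simpa using hρ.smul 0 (fun _ => 0) aemeasurable_const
      change ρ _ ≤ 1
      refine le_trans (le_of_eq ?_) zero_le_one
      rw [← h0]
      refine hρ.congr (Lp.aestronglyMeasurable _).enorm aemeasurable_const ?_
      filter_upwards [Lp.coeFn_zero ℝ 2 (volume : Measure (Rn n))] with x hx
      rw [hx]; simp
    simpa using hφ 0 this
  have hc : u.toNNReal ≠ 0 := by simpa using hu0
  have hass : associate ρ (fun x => ((u.toNNReal)⁻¹ : ℝ≥0) * ‖g x‖ₑ) ≤ 1 := by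
    rw [associate_const_mul, ENNReal.coe_inv hc]
    rw [ENNReal.inv_mul_le_iff (by simpa using hu0) (by simp), mul_one]
    exact iSup_le fun h => iSup_le fun hh => iSup_le fun h1 =>
      hρ.lintegral_le_of_unitBall hφ hg hh h1.le
  have h3 := hd _ (hgm.enorm.const_mul _) hass
  have h4 : ∫⁻ x, f x * ‖g x‖ₑ ≤ u.toNNReal := by
    simp_rw [mul_left_comm (f _)] at h3
    rw [lintegral_const_mul' _ _ ENNReal.coe_ne_top, ENNReal.coe_inv hc,
      ENNReal.inv_mul_le_iff (by simpa using hu0) (by simp), mul_one] at h3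
    exact h3
  have h5 : ENNReal.ofReal (φ (h2.toLp _)) ≤ ∫⁻ x, f x * ‖g x‖ₑ := by
    rw [hg]
    refine le_trans ?_ ((enorm_integral_le_lintegral_enorm (μ := volume)
      fun x => g x * h2.toLp _ x).trans (le_of_eq ?_))
    · rw [Real.enorm_eq_ofReal_abs]
      exact ENNReal.ofReal_le_ofReal (le_abs_self _)
    · refine lintegral_congr_ae ?_
      filter_upwards [h2.coeFn_toLp] with x hx
      rw [hx, enorm_mul, hfx, mul_comm]
  have h6 := h5.trans h4
  have h7 : ENNReal.ofReal (φ (h2.toLp _)) ≤ ENNReal.ofReal u := h6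
  rw [ENNReal.ofReal_le_ofReal_iff hu0.le] at h7
  linarith

theorem IsBallBanach.le_of_duality (hρ : IsBallBanach ρ) {f : Rn n → ℝ≥0∞}
    (hf : AEMeasurable f volume) (hfin : ∀ x, f x ≠ ∞)
    (h2 : MemLp (fun x => (f x).toReal) 2 volume) {K : ℝ≥0}
    (hd : ∀ g : Rn n → ℝ≥0∞, AEMeasurable g volume → associate ρ g ≤ 1 → ∫⁻ x, f x * g x ≤ K) :
    ρ f ≤ K := by
  -- K may be zero; the added ε permits dividing by the bound.
  refine ENNReal.le_of_forall_pos_le_add fun ε hε _ => ?_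
  replace hd : ∀ g : Rn n → ℝ≥0∞, AEMeasurable g volume → associate ρ g ≤ 1 →
      ∫⁻ x, f x * g x ≤ (K + ε : ℝ≥0) := fun g hg h1 =>
    (hd g hg h1).trans (by exact_mod_cast le_self_add)
  rw [← ENNReal.coe_add]
  have hK : K + ε ≠ 0 := by positivity
  generalize K + ε = K at hd hK ⊢
  have hK' : (K : ℝ≥0∞) ≠ 0 := by simpa using hK
  have h1 : ρ (fun x => (K⁻¹ : ℝ≥0) * f x) ≤ 1 := by
    refine hρ.le_one_of_duality (hf.const_mul _)
      (fun x => ENNReal.mul_ne_top ENNReal.coe_ne_top (hfin x)) ?_ fun g hg hg1 => ?_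
    · simpa using h2.const_mul ((K⁻¹ : ℝ≥0) : ℝ)
    · simp_rw [mul_assoc]
      rw [lintegral_const_mul' _ _ ENNReal.coe_ne_top, ENNReal.coe_inv hK,
        ENNReal.inv_mul_le_iff hK' (by simp), mul_one]
      exact hd g hg hg1
  rwa [hρ.smul _ _ hf, ENNReal.coe_inv hK, ENNReal.inv_mul_le_iff hK' (by simp), mul_one] at h1

/-- An inclusion into the function space of a monotone, homogeneous `σ` of the associate space of
`ρ` is bounded. -/
theorem IsBallQuasiBanach.exists_bound_of_space_subset (hρ : IsBallQuasiBanach ρ)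
    {σ : FunctionNorm n}
    (hmono : ∀ f g : Rn n → ℝ≥0∞, (∀ᵐ x, f x ≤ g x) → σ f ≤ σ g)
    (hsmul : ∀ (c : ℝ≥0) (f : Rn n → ℝ≥0∞), σ (fun x => c * f x) = c * σ f)
    (hsub : space (associate ρ) ⊆ space σ) :
    ∃ K : ℝ≥0, ∀ g : Rn n → ℝ≥0∞, AEMeasurable g volume → associate ρ g ≤ 1 → σ g ≤ K := by
  by_contra! hcon
  -- Gliding hump: ∑ 2^(-k) g_k has finite associate norm, but each of its terms forces σ of the sum
  -- to be at least 2^k.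
  choose g hg hg1 hgK using fun k : ℕ => hcon (4 ^ k)
  set c : ℕ → ℝ≥0 := fun k => 2⁻¹ ^ k
  set f : Rn n → ℝ≥0∞ := fun x => ∑' k, c k * g k x with hf
  have hfm : AEMeasurable f volume := AEMeasurable.tsum fun k => (hg k).const_mul _
  have hfρ : associate ρ f < ∞ := by
    refine (associate_tsum_le fun k => (hg k).const_mul _).trans_lt ?_
    refine lt_of_le_of_lt (b := ∑' k : ℕ, (2⁻¹ : ℝ≥0∞) ^ k) (ENNReal.tsum_le_tsum fun k => ?_) ?_
    · rw [associate_const_mul]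
      refine (mul_le_of_le_one_right' (hg1 k)).trans (le_of_eq ?_)
      simp [c, ENNReal.inv_pow]
    · rw [ENNReal.tsum_geometric]; simp
  have hfin := hρ.ae_lt_top_of_associate hfm hfρ
  have hmem : (fun x => (((f x).toReal : ℝ) : ℂ)) ∈ space (associate ρ) :=
    ⟨Complex.measurable_ofReal.comp_aemeasurable hfm.ennreal_toReal,
      (associate_mono (hfin.mono fun x hx => (enorm_toReal hx).le)).trans_lt hfρ⟩
  have hσ := (hsub hmem).2
  have hσ' : σ f < ∞ := (hmono _ _ (hfin.mono fun x hx => (enorm_toReal hx).ge)).trans_lt hσ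
  have hk : ∀ k : ℕ, (2 : ℝ≥0∞) ^ k ≤ σ f := fun k => by
    have h1 : σ (fun x => c k * g k x) ≤ σ f :=
      hmono _ _ (Eventually.of_forall fun x => ENNReal.le_tsum (f := fun k => c k * g k x) k)
    rw [hsmul] at h1
    refine le_trans ?_ (h1.trans' (mul_le_mul_right (hgK k).le _))
    rw [← ENNReal.coe_mul, ← mul_pow, show (2⁻¹ * 4 : ℝ≥0) = 2 by
      rw [show (4 : ℝ≥0) = 2 * 2 by norm_num, ← mul_assoc, inv_mul_cancel₀ two_ne_zero, one_mul]]
    simp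
  have := le_of_tendsto' (ENNReal.tendsto_pow_atTop_nhds_top_iff.mpr ENNReal.one_lt_two) hk
  exact absurd hσ' (by simpa using this)

/-! ### Cubes, the maximal function and A₁ weights -/

theorem volume_setOf_coord (s : Fin n → Set ℝ) :
    volume {x : Rn n | ∀ i, x i ∈ s i} = ∏ i, volume (s i) := by
  rw [← volume_pi_pi s, ← (EuclideanSpace.volume_preserving_symm_measurableEquiv_toLp
    (Fin n)).measure_preimage_equiv]
  congr 1
  ext x
  simp [Set.mem_pi]

theorem setOf_abs_sub_le_eq (c : Rn n) (r : ℝ) :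
    {y : Rn n | ∀ i, |y i - c i| ≤ r} = {y | ∀ i, y i ∈ Set.Icc (c i - r) (c i + r)} := by
  ext y
  refine forall_congr' fun i => ?_
  rw [abs_le, Set.mem_Icc]
  constructor <;> rintro ⟨h1, h2⟩ <;> constructor <;> linarith

theorem isClosed_setOf_abs_sub_le (c : Rn n) (r : ℝ) :
    IsClosed {y : Rn n | ∀ i, |y i - c i| ≤ r} := by
  simp only [Set.ofPred_forall]
  exact isClosed_iInter fun i => isClosed_le (by fun_prop) continuous_const

theorem Cube.measurableSet_toSet (Q : Cube n) : MeasurableSet Q.toSet :=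
  (isClosed_setOf_abs_sub_le Q.center (Q.side / 2)).measurableSet

theorem Cube.measurableSet_star (Q : Cube n) : MeasurableSet Q.star :=
  (isClosed_setOf_abs_sub_le Q.center (100 * Real.sqrt n * Q.side / 2)).measurableSet

theorem Cube.volume_toSet (Q : Cube n) : volume Q.toSet = ENNReal.ofReal Q.side ^ n := by
  have h := setOf_abs_sub_le_eq Q.center (Q.side / 2)
  rw [Cube.toSet, h, volume_setOf_coord (fun i =>
    Set.Icc (Q.center i - Q.side / 2) (Q.center i + Q.side / 2))]
  simp

theorem Cube.volume_ne_zero (Q : Cube n) : volume Q.toSet ≠ 0 := by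
  rw [Q.volume_toSet]
  exact pow_ne_zero _ (by simpa using Q.side_pos)

theorem Cube.volume_ne_top (Q : Cube n) : volume Q.toSet ≠ ∞ := by
  rw [Q.volume_toSet]
  exact ENNReal.pow_ne_top ENNReal.ofReal_ne_top

theorem Cube.setLIntegral_le (Q : Cube n) (f : Rn n → ℝ≥0∞) {x : Rn n} (hx : x ∈ Q.toSet) :
    ∫⁻ y in Q.toSet, f y ≤ volume Q.toSet * maximal f x := by
  have h : (volume Q.toSet)⁻¹ * ∫⁻ y in Q.toSet, f y ≤ maximal f x :=
    le_iSup_of_le Q (le_iSup_of_le hx le_rfl)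
  rwa [ENNReal.inv_mul_le_iff Q.volume_ne_zero Q.volume_ne_top] at h

/-- Enlarging a cube slightly keeps its average above the given level and makes it a neighbourhood
of x. The supremum is uncountable, so measurability of the maximal function comes from here. -/
theorem lowerSemicontinuous_maximal (f : Rn n → ℝ≥0∞) : LowerSemicontinuous (maximal f) := by
  intro x y hy
  obtain ⟨Q, hQ⟩ := lt_iSup_iff.mp hy
  obtain ⟨hx, hlt⟩ := lt_iSup_iff.mp hQ
  have hlim : Tendsto (fun t : ℝ => (ENNReal.ofReal (Q.side + t) ^ n)⁻¹ * ∫⁻ y in Q.toSet, f y)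
      (𝓝 0) (𝓝 ((volume Q.toSet)⁻¹ * ∫⁻ y in Q.toSet, f y)) := by
    refine ENNReal.Tendsto.mul_const ?_ (Or.inl (ENNReal.inv_ne_zero.mpr Q.volume_ne_top))
    rw [Q.volume_toSet]
    have : Continuous fun t : ℝ => (ENNReal.ofReal (Q.side + t) ^ n)⁻¹ :=
      continuous_inv.comp ((ENNReal.continuous_pow n).comp
        (ENNReal.continuous_ofReal.comp (continuous_const.add continuous_id)))
    simpa using this.tendsto 0
  obtain ⟨t, ht, ht0⟩ := (((hlim.eventually (lt_mem_nhds hlt)).filter_mono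
    (nhdsWithin_le_nhds (s := Set.Ioi 0))).and self_mem_nhdsWithin).exists
  have ht0' : 0 < t := ht0
  let Q' : Cube n := ⟨Q.center, Q.side + t, by linarith [Q.side_pos]⟩
  have hsub : Q.toSet ⊆ Q'.toSet := fun z hz i => (hz i).trans (by simp only [Q']; linarith)
  have hopen : ∀ᶠ z in 𝓝 x, z ∈ Q'.toSet := by
    refine Filter.mem_of_superset (Metric.ball_mem_nhds x (half_pos ht0')) fun z hz i => ?_
    have h1 : |z i - x i| ≤ dist z x := by
      rw [dist_eq_norm]
      exact (Real.norm_eq_abs _).ge.trans (PiLp.norm_apply_le (z - x) i)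
    have h2 : dist z x < t / 2 := hz
    have h3 := hx i
    have h4 := abs_sub_le (z i) (x i) (Q.center i)
    simp only [Q']
    linarith
  filter_upwards [hopen] with z hz
  refine lt_of_lt_of_le ht (le_iSup_of_le Q' (le_iSup_of_le hz ?_))
  rw [Q'.volume_toSet]
  exact mul_le_mul_right (lintegral_mono_set hsub) _

theorem measurable_maximal (f : Rn n → ℝ≥0∞) : Measurable (maximal f) :=
  (lowerSemicontinuous_maximal f).measurable

theorem maximal_congr {f g : Rn n → ℝ≥0∞} (h : ∀ᵐ x, f x = g x) : maximal f = maximal g := by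
  funext x
  refine iSup_congr fun Q => iSup_congr fun _ => ?_
  rw [lintegral_congr_ae (ae_restrict_of_ae h)]

theorem maximal_const_mul (c : ℝ≥0) (f : Rn n → ℝ≥0∞) (x : Rn n) :
    maximal (fun y => c * f y) x = c * maximal f x := by
  simp only [maximal, ENNReal.mul_iSup]
  refine iSup_congr fun Q => iSup_congr fun _ => ?_
  rw [lintegral_const_mul' _ _ ENNReal.coe_ne_top, mul_left_comm]

theorem maximal_tsum_le {F : ℕ → Rn n → ℝ≥0∞} (hF : ∀ k, AEMeasurable (F k) volume) (x : Rn n) :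
    maximal (fun y => ∑' k, F k y) x ≤ ∑' k, maximal (F k) x := by
  refine iSup_le fun Q => iSup_le fun hx => ?_
  rw [lintegral_tsum fun k => (hF k).restrict, ← ENNReal.tsum_mul_left]
  exact ENNReal.tsum_le_tsum fun k => le_iSup_of_le Q (le_iSup_of_le hx le_rfl)

theorem IsBallQuasiBanach.exists_maximal_bound (hρ : IsBallQuasiBanach ρ)
    (hM : MaximalBounded (associate ρ)) : ∃ C : ℝ≥0, ∀ g : Rn n → ℝ≥0∞,
      AEMeasurable g volume → associate ρ g < ∞ →
        associate ρ (maximal g) ≤ C * associate ρ g := by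
  obtain ⟨C, hC⟩ := hM
  refine ⟨C, fun g hg hfin => ?_⟩
  have htop := hρ.ae_lt_top_of_associate hg hfin
  have he : ∀ᵐ x, ‖(((g x).toReal : ℝ) : ℂ)‖ₑ = g x := htop.mono fun x hx => enorm_toReal hx
  have h1 : associate ρ (fun x => ‖(((g x).toReal : ℝ) : ℂ)‖ₑ) = associate ρ g :=
    le_antisymm (associate_mono (he.mono fun x hx => hx.le))
      (associate_mono (he.mono fun x hx => hx.ge))
  have h2 := hC (fun x => (((g x).toReal : ℝ) : ℂ))
    ⟨Complex.measurable_ofReal.comp_aemeasurable hg.ennreal_toReal, h1.trans_lt hfin⟩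
  rwa [h1, maximal_congr he] at h2

/-- The Rubio de Francia algorithm: every function in the unit ball of the associate space has a
majorant of comparable norm which is a Muckenhoupt `A₁` weight. -/
theorem IsBallQuasiBanach.exists_weight (hρ : IsBallQuasiBanach ρ)
    (hM : MaximalBounded (associate ρ)) : ∃ C : ℝ≥0, C ≠ 0 ∧ ∀ g : Rn n → ℝ≥0∞,
      AEMeasurable g volume → associate ρ g ≤ 1 → ∃ W : Rn n → ℝ≥0∞, AEMeasurable W volume ∧
        (∀ x, g x ≤ W x) ∧ associate ρ W ≤ 2 ∧ ∀ x, maximal W x ≤ C * W x := by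
  obtain ⟨C₀, hC₀⟩ := hρ.exists_maximal_bound hM
  set C₁ : ℝ≥0 := C₀ + 1
  have hC₁ : C₁ ≠ 0 := by positivity
  refine ⟨2 * C₁, by positivity, fun g hg hg1 => ?_⟩
  set G : ℕ → Rn n → ℝ≥0∞ := fun k => maximal^[k] g
  have hGs : ∀ k, G (k + 1) = maximal (G k) := fun k => Function.iterate_succ_apply' _ _ _
  have hGm : ∀ k, AEMeasurable (G k) volume := fun k => by
    cases k with
    | zero => exact hg
    | succ k => rw [hGs]; exact (measurable_maximal _).aemeasurable
  have hGρ : ∀ k, associate ρ (G k) ≤ (C₁ ^ k : ℝ≥0) := fun k => by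
    induction k with
    | zero => simpa [G] using hg1
    | succ k ih =>
      rw [hGs, pow_succ', ENNReal.coe_mul]
      exact (hC₀ _ (hGm k) (ih.trans_lt ENNReal.coe_lt_top)).trans
        (mul_le_mul' (by exact_mod_cast le_self_add) ih)
  -- With these weights the k-th term has norm at most 2^(-k), and applying the maximal operator
  -- shifts the series by one index at the cost of the factor 2 C₁.
  set c : ℕ → ℝ≥0 := fun k => (2 * C₁)⁻¹ ^ k
  set W : Rn n → ℝ≥0∞ := fun x => ∑' k, c k * G k x
  refine ⟨W, AEMeasurable.tsum fun k => (hGm k).const_mul _, fun x => ?_, ?_, fun x => ?_⟩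
  · refine le_trans (le_of_eq ?_) (ENNReal.le_tsum (f := fun k => c k * G k x) 0)
    simp [c, G]
  · refine (associate_tsum_le fun k => (hGm k).const_mul _).trans ?_
    refine le_trans (b := ∑' k : ℕ, (2⁻¹ : ℝ≥0∞) ^ k) (ENNReal.tsum_le_tsum fun k => ?_) ?_
    · rw [associate_const_mul]
      refine (mul_le_mul_right (hGρ k) _).trans (le_of_eq ?_)
      rw [← ENNReal.coe_mul, ← mul_pow, mul_inv, mul_assoc, inv_mul_cancel₀ hC₁, mul_one]
      simp [ENNReal.inv_pow]
    · rw [ENNReal.tsum_geometric]; simp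
  · refine (maximal_tsum_le (fun k => (hGm k).const_mul _) x).trans ?_
    simp only [maximal_const_mul, ← hGs, W]
    rw [← ENNReal.tsum_mul_left]
    calc ∑' k, (c k : ℝ≥0∞) * G (k + 1) x
        = ∑' k, ((2 * C₁ : ℝ≥0) : ℝ≥0∞) * (c (k + 1) * G (k + 1) x) := by
          refine tsum_congr fun k => ?_
          rw [← mul_assoc, ← ENNReal.coe_mul]
          congr 2
          simp only [c]
          rw [pow_succ', ← mul_assoc, mul_inv_cancel₀ (by positivity), one_mul]
      _ ≤ _ := by
        exact ENNReal.tsum_comp_le_tsum_of_injective (add_left_injective 1)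
          (fun k => ((2 * C₁ : ℝ≥0) : ℝ≥0∞) * (c k * G k x))

/-! ### Dyadic cubes and their dilates -/

/-- The half-open dyadic cube of side length `2 ^ k` with lowest corner `2 ^ k • m`. -/
def dyadicCube (k : ℤ) (m : Fin n → ℤ) : Set (Rn n) :=
  {x | ∀ i, x i ∈ Set.Ico (m i * (2 : ℝ) ^ k) ((m i + 1) * (2 : ℝ) ^ k)}

theorem mem_dyadicCube {k : ℤ} {m : Fin n → ℤ} {x : Rn n} :
    x ∈ dyadicCube k m ↔ ∀ i, ⌊x i / (2 : ℝ) ^ k⌋ = m i := by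
  refine forall_congr' fun i => ?_
  have h : (0 : ℝ) < 2 ^ k := by positivity
  rw [Int.floor_eq_iff, le_div_iff₀ h, div_lt_iff₀ h, Set.mem_Ico]

theorem measurableSet_dyadicCube (k : ℤ) (m : Fin n → ℤ) : MeasurableSet (dyadicCube k m) := by
  simp only [dyadicCube, Set.ofPred_forall]
  exact MeasurableSet.iInter fun i =>
    (show Measurable fun x : Rn n => x i by fun_prop) measurableSet_Ico

theorem volume_dyadicCube (k : ℤ) (m : Fin n → ℤ) :
    volume (dyadicCube k m) = ENNReal.ofReal (2 ^ k) ^ n := by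
  rw [dyadicCube, volume_setOf_coord fun i =>
    Set.Ico (m i * (2 : ℝ) ^ k) ((m i + 1) * (2 : ℝ) ^ k)]
  simp [Real.volume_Ico, add_mul]

theorem corner_mem_dyadicCube (k : ℤ) (m : Fin n → ℤ) :
    (WithLp.toLp 2 fun i => m i * (2 : ℝ) ^ k : Rn n) ∈ dyadicCube k m := by
  intro i
  have h : (0 : ℝ) < 2 ^ k := by positivity
  simp [add_mul, h]

theorem floor_div_two_zpow {k k' : ℤ} (h : k ≤ k') (a : ℝ) :
    ⌊a / (2 : ℝ) ^ k'⌋ = ⌊a / (2 : ℝ) ^ k⌋ / 2 ^ (k' - k).toNat := by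
  have h1 : a / (2 : ℝ) ^ k' = a / (2 : ℝ) ^ k / ((2 ^ (k' - k).toNat : ℕ) : ℝ) := by
    rw [div_div]
    push_cast
    rw [← zpow_natCast, Int.toNat_of_nonneg (by linarith), ← zpow_add₀ two_ne_zero]
    congr 2; ring
  rw [h1, Int.floor_div_natCast]
  push_cast; rfl

theorem dyadicCube_subset {k k' : ℤ} (h : k ≤ k') {m m' : Fin n → ℤ} {x : Rn n}
    (hx : x ∈ dyadicCube k m) (hx' : x ∈ dyadicCube k' m') :
    dyadicCube k m ⊆ dyadicCube k' m' := by
  intro y hy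
  rw [mem_dyadicCube] at *
  intro i
  rw [← hx' i, floor_div_two_zpow h, floor_div_two_zpow h, hx i, hy i]

theorem le_of_dyadicCube_subset {k k' : ℤ} (h : k ≤ k') {m m' : Fin n → ℤ}
    (hsub : dyadicCube k m ⊆ dyadicCube k' m') (i : Fin n) :
    m' i * (2 : ℝ) ^ k' ≤ m i * (2 : ℝ) ^ k ∧
      (m i + 1) * (2 : ℝ) ^ k ≤ (m' i + 1) * (2 : ℝ) ^ k' := by
  have h1 := hsub (corner_mem_dyadicCube k m) i
  refine ⟨h1.1, ?_⟩
  have hk : (0 : ℝ) < 2 ^ k := by positivity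
  have h2 : (2 : ℝ) ^ k' = 2 ^ (k' - k).toNat * 2 ^ k := by
    rw [← zpow_natCast, Int.toNat_of_nonneg (by linarith), ← zpow_add₀ two_ne_zero]
    congr 1; ring
  have h3 : (m i : ℝ) * 2 ^ k < (m' i + 1) * 2 ^ k' := h1.2
  rw [h2, ← mul_assoc, mul_lt_mul_iff_left₀ hk] at h3
  rw [h2, ← mul_assoc, mul_le_mul_iff_left₀ hk]
  -- Between integers the strict inequality improves by one, which carries it from the lower corner
  -- to the upper one.
  have h4 : m i < (m' i + 1) * 2 ^ (k' - k).toNat := by exact_mod_cast h3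
  exact_mod_cast h4

theorem Cube.exists_dyadicCube (Q : Cube n) : ∃ (k : ℤ) (m : Fin n → ℤ),
    dyadicCube k m ⊆ Q.toSet ∧ Q.side ≤ 4 * 2 ^ k := by
  -- Each edge of Q has length at least 2 · 2^k, so it contains the dyadic interval starting at the
  -- first multiple of 2^k past its lower end.
  obtain ⟨k, hk1, hk2⟩ := exists_mem_Ico_zpow (half_pos Q.side_pos) one_lt_two
  rw [zpow_add_one₀ two_ne_zero] at hk2
  have hk : (0 : ℝ) < 2 ^ k := by positivity
  refine ⟨k, fun i => ⌈(Q.center i - Q.side / 2) / 2 ^ k⌉, fun x hx i => ?_, by linarith⟩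
  obtain ⟨h1, h2⟩ := hx i
  have h3 := Int.le_ceil ((Q.center i - Q.side / 2) / (2 : ℝ) ^ k)
  have h4 := Int.ceil_lt_add_one ((Q.center i - Q.side / 2) / (2 : ℝ) ^ k)
  dsimp only at h1 h2
  generalize ⌈(Q.center i - Q.side / 2) / (2 : ℝ) ^ k⌉ = m at *
  rw [div_le_iff₀ hk] at h3
  rw [← sub_lt_iff_lt_add, lt_div_iff₀ hk] at h4
  rw [abs_le]
  constructor <;> linarith

/-- The cube concentric with a dyadic cube whose side length is larger by the factor `2 D + 1`. -/
noncomputable def dilatedCube (D : ℝ≥0) (k : ℤ) (m : Fin n → ℤ) : Cube n where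
  center := WithLp.toLp 2 fun i => (m i + 1 / 2) * (2 : ℝ) ^ k
  side := (2 * D + 1) * 2 ^ k
  side_pos := by positivity

theorem mem_dilatedCube {D : ℝ≥0} {k : ℤ} {m : Fin n → ℤ} {x : Rn n} :
    x ∈ (dilatedCube D k m).toSet ↔
      ∀ i, (m i - (D : ℝ)) * (2 : ℝ) ^ k ≤ x i ∧ x i ≤ (m i + 1 + D) * (2 : ℝ) ^ k := by
  refine forall_congr' fun i => ?_
  simp only [dilatedCube, abs_le]
  constructor <;> rintro ⟨h1, h2⟩ <;> constructor <;> linarith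

theorem dyadicCube_subset_dilatedCube (D : ℝ≥0) (k : ℤ) (m : Fin n → ℤ) :
    dyadicCube k m ⊆ (dilatedCube D k m).toSet := by
  intro x hx
  rw [mem_dilatedCube]
  intro i
  have h1 := hx i
  have h2 : 0 ≤ (D : ℝ) * 2 ^ k := by positivity
  constructor <;> linarith [h1.1, h1.2]

theorem dilatedCube_subset (D : ℝ≥0) {k k' : ℤ} (h : k ≤ k') {m m' : Fin n → ℤ}
    (hsub : dyadicCube k m ⊆ dyadicCube k' m') :
    (dilatedCube D k m).toSet ⊆ (dilatedCube D k' m').toSet := by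
  intro x hx
  rw [mem_dilatedCube] at *
  intro i
  obtain ⟨h1, h2⟩ := le_of_dyadicCube_subset h hsub i
  obtain ⟨h3, h4⟩ := hx i
  have h5 : (D : ℝ) * 2 ^ k ≤ D * 2 ^ k' := by gcongr; exact one_le_two
  constructor <;> linarith

/-- `Q.star` reaches 50 √n · side ≤ 200 √n · 2^k from the centre of Q, which is within side / 2 ≤ 2
· 2^k of the corner of the dyadic cube. -/
theorem Cube.star_subset_dilatedCube (Q : Cube n) {k : ℤ} {m : Fin n → ℤ}
    (hsub : dyadicCube k m ⊆ Q.toSet) (hside : Q.side ≤ 4 * 2 ^ k) :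
    Q.star ⊆ (dilatedCube (200 * NNReal.sqrt n + 2) k m).toSet := by
  intro x hx
  rw [mem_dilatedCube]
  intro i
  have h1 := abs_le.mp (hsub (corner_mem_dyadicCube k m) i)
  have h2 := abs_le.mp (hx i)
  have h3 : Real.sqrt n * Q.side ≤ Real.sqrt n * (4 * 2 ^ k) := by gcongr
  have h4 : ((200 * NNReal.sqrt n + 2 : ℝ≥0) : ℝ) = 200 * Real.sqrt n + 2 := by simp
  have hk : (0 : ℝ) < 2 ^ k := by positivity
  rw [h4]
  simp only at h1
  constructor <;> linarith [h1.1, h1.2, h2.1, h2.2]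

/-! ### The weighted inequality for cubes -/

theorem exists_sort_antitone (k : ℕ → ℤ) (N : ℕ) : ∃ e : ℕ → ℕ,
    (∀ i j, i ≤ j → j < N → k (e j) ≤ k (e i)) ∧
    ∀ f : ℕ → ℝ≥0∞, ∑ j ∈ Finset.range N, f (e j) = ∑ j ∈ Finset.range N, f j := by
  set σ := Tuple.sort fun i : Fin N => -k i
  refine ⟨fun j => if h : j < N then σ ⟨j, h⟩ else 0, fun i j hij hj => ?_, fun f => ?_⟩
  · have h := Tuple.monotone_sort (fun i : Fin N => -k i)
      (show (⟨i, hij.trans_lt hj⟩ : Fin N) ≤ ⟨j, hj⟩ from hij)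
    simp only [hij.trans_lt hj, hj, dif_pos]
    exact neg_le_neg_iff.mp h
  · rw [Finset.sum_range, Finset.sum_range]
    simp only [Fin.is_lt, dif_pos, Fin.eta]
    exact Equiv.sum_comp σ fun i : Fin N => f i

/-- The two-weight fractional inequality for finite sums over cubes, for `A₁` weights. -/
theorem lintegral_rpow_sum_star_le (n : ℕ) (C : ℝ≥0) (hC : C ≠ 0) {p q s : ℝ} (hp : 0 < p)
    (hpq : p < q) (hq1 : q ≤ 1) (hs : 0 ≤ s) (hexp : q / p = 1 + s * q) :
    ∃ K : ℝ≥0∞, K ≠ ∞ ∧ ∀ (W : Rn n → ℝ≥0∞), AEMeasurable W volume →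
      (∀ x, maximal W x ≤ C * W x) → ∀ (l : ℕ → ℝ≥0∞) (Q : ℕ → Cube n), (∀ j, l j ≠ 0) →
      (∀ j, l j ≠ ∞) → ∀ N : ℕ,
      ∫⁻ x, (∑ j ∈ Finset.range N,
          l j * volume (Q j).toSet ^ s * (Q j).star.indicator (fun _ => 1) x) ^ q * W x ≤
        K * (∫⁻ x, (∑ j ∈ Finset.range N, l j * (Q j).toSet.indicator (fun _ => 1) x) ^ p *
          W x ^ (p / q)) ^ (q / p) := by
  have hq : 0 < q := hp.trans hpq
  set D : ℝ≥0 := 200 * NNReal.sqrt n + 2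
  -- The A₁ constant times the ratio (2 D + 1)^n of the volumes of a dilated cube and its dyadic
  -- cube.
  set A : ℝ≥0∞ := ENNReal.ofReal (2 * D + 1) ^ n * C
  have hA : A ≠ 0 := mul_ne_zero (pow_ne_zero _ (by
    rw [Ne, ENNReal.ofReal_eq_zero, not_le]; positivity)) (by simpa using hC)
  have hA' : A ≠ ∞ := ENNReal.mul_ne_top (ENNReal.pow_ne_top ENNReal.ofReal_ne_top)
    ENNReal.coe_ne_top
  -- The cost of replacing |Q|^s by the same power of the dyadic volume, since the side of Q is at
  -- most 4 · 2^k.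
  set T : ℝ≥0∞ := ((4 : ℝ≥0∞) ^ n) ^ s
  have hT : T ≠ ∞ := ENNReal.rpow_ne_top_of_nonneg hs (ENNReal.pow_ne_top (by simp))
  refine ⟨T ^ q * (A * (ENNReal.ofReal p)⁻¹), ENNReal.mul_ne_top
    (ENNReal.rpow_ne_top_of_nonneg hq.le hT) (ENNReal.mul_ne_top hA' (by simpa using hp)), ?_⟩
  intro W hWm hW l Q hl hl' N
  choose k m hsub hside using fun j => (Q j).exists_dyadicCube
  obtain ⟨e, hek, hesum⟩ := exists_sort_antitone k N
  set v : ℕ → ℝ≥0∞ := fun j => ENNReal.ofReal (2 ^ k j) ^ n with hv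
  have key := lintegral_rpow_sum_le (μ := volume)
    (P := fun j => dyadicCube (k (e j)) (m (e j)))
    (E := fun j => (dilatedCube D (k (e j)) (m (e j))).toSet) (W := W) (C := A)
    (v := fun j => v (e j)) (l := fun j => l (e j)) (p := p) (q := q) (s := s) (N := N)
    (fun j => measurableSet_dyadicCube _ _) (fun j => Cube.measurableSet_toSet _) hWm hA hA'
    (fun j => pow_ne_zero _ (by rw [Ne, ENNReal.ofReal_eq_zero, not_le]; positivity))
    (fun j => ENNReal.pow_ne_top ENNReal.ofReal_ne_top) (fun j => hl _) (fun j => hl' _)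
    (fun j => (volume_dyadicCube _ _).ge)
    (fun i j hij hj => by
      have := hek i j hij hj
      simp only [hv]
      gcongr
      exact one_le_two)
    (fun i j hij hj x hxi hxj => dyadicCube_subset (hek i j hij hj) hxj hxi)
    (fun i j hij hj h => dilatedCube_subset D (hek i j hij hj) h)
    (fun j x hx => by
      refine (Cube.setLIntegral_le _ W (dyadicCube_subset_dilatedCube D _ _ hx)).trans ?_
      refine (mul_le_mul_right (hW x) _).trans (le_of_eq ?_)
      rw [Cube.volume_toSet]
      simp only [dilatedCube, hv, A]
      rw [ENNReal.ofReal_mul (by positivity), mul_pow]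
      ring)
    hp hpq hq1 hs hexp
  simp_rw [fun x => hesum fun j =>
      (dilatedCube D (k j) (m j)).toSet.indicator (fun _ => l j * v j ^ s) x,
    fun x => hesum fun j => (dyadicCube (k j) (m j)).indicator (fun _ => l j) x] at key
  have hstar : ∀ x, (∑ j ∈ Finset.range N,
      l j * volume (Q j).toSet ^ s * (Q j).star.indicator (fun _ => 1) x) ≤
      T * ∑ j ∈ Finset.range N,
        (dilatedCube D (k j) (m j)).toSet.indicator (fun _ => l j * v j ^ s) x := by
    intro x
    rw [Finset.mul_sum]
    refine Finset.sum_le_sum fun j _ => ?_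
    by_cases hx : x ∈ (Q j).star
    · rw [Set.indicator_of_mem hx, mul_one,
        Set.indicator_of_mem ((Q j).star_subset_dilatedCube (hsub j) (hside j) hx),
        mul_left_comm, ← ENNReal.mul_rpow_of_nonneg _ _ hs]
      gcongr
      rw [Cube.volume_toSet, hv, ← mul_pow]
      gcongr
      refine (ENNReal.ofReal_le_ofReal (hside j)).trans (le_of_eq ?_)
      rw [ENNReal.ofReal_mul (by norm_num)]
      norm_num
    · simp [Set.indicator_of_notMem hx]
  calc _ ≤ ∫⁻ x, T ^ q * ((∑ j ∈ Finset.range N,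
        (dilatedCube D (k j) (m j)).toSet.indicator (fun _ => l j * v j ^ s) x) ^ q * W x) := by
        refine lintegral_mono fun x => ?_
        rw [← mul_assoc, ← ENNReal.mul_rpow_of_nonneg _ _ hq.le]
        exact mul_le_mul_left (ENNReal.rpow_le_rpow (hstar x) hq.le) _
    _ ≤ T ^ q * (A * (ENNReal.ofReal p)⁻¹ * (∫⁻ x, (∑ j ∈ Finset.range N,
        (dyadicCube (k j) (m j)).indicator (fun _ => l j) x) ^ p * W x ^ (p / q)) ^ (q / p)) := by
        rw [lintegral_const_mul' _ _ (ENNReal.rpow_ne_top_of_nonneg hq.le hT)]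
        gcongr
    _ ≤ _ := by
        rw [← mul_assoc]
        gcongr with x j hj
        by_cases hx : x ∈ dyadicCube (k j) (m j)
        · simp [hx, hsub j hx]
        · simp [hx]

/-! ### From weights to the spaces X and Y -/

theorem Cube.volume_star_ne_top (Q : Cube n) : volume Q.star ≠ ∞ := by
  have h := setOf_abs_sub_le_eq Q.center (100 * Real.sqrt n * Q.side / 2)
  rw [Cube.star, h, volume_setOf_coord (fun i =>
    Set.Icc (Q.center i - 100 * Real.sqrt n * Q.side / 2)
      (Q.center i + 100 * Real.sqrt n * Q.side / 2))]
  simp only [Real.volume_Icc]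
  exact (ENNReal.prod_lt_top fun i _ => ENNReal.ofReal_lt_top).ne

/-- A finite sum is bounded and supported in a set of finite measure; this gives the square
integrability that duality requires. -/
theorem memLp_rpow_sum_star {c : ℕ → ℝ≥0∞} (hc : ∀ j, c j ≠ ∞) (Q : ℕ → Cube n) {q : ℝ}
    (hq : 0 < q) (N : ℕ) :
    MemLp (fun x => ((∑ j ∈ Finset.range N,
      c j * (Q j).star.indicator (fun _ => 1) x) ^ q).toReal) 2 volume := by
  have hS : MeasurableSet (⋃ j ∈ Finset.range N, (Q j).star) :=
    Finset.measurableSet_biUnion _ fun j _ => (Q j).measurableSet_star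
  have hSv : volume (⋃ j ∈ Finset.range N, (Q j).star) ≠ ∞ :=
    (measure_biUnion_lt_top (Finset.finite_toSet _) fun j _ =>
      (Q j).volume_star_ne_top.lt_top).ne
  have hB : (∑ j ∈ Finset.range N, c j) ^ q ≠ ∞ := ENNReal.rpow_ne_top_of_nonneg hq.le
    (ENNReal.sum_lt_top.mpr fun j _ => (hc j).lt_top).ne
  refine MemLp.mono (memLp_indicator_const 2 hS ((∑ j ∈ Finset.range N, c j) ^ q).toReal
    (Or.inr hSv)) ?_ (Eventually.of_forall fun x => ?_)
  · exact ((Finset.measurable_sum _ fun j _ => (measurable_const.indicator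
      (Q j).measurableSet_star).const_mul _).pow_const _).ennreal_toReal.aestronglyMeasurable
  · rw [Real.norm_of_nonneg ENNReal.toReal_nonneg]
    by_cases hx : x ∈ ⋃ j ∈ Finset.range N, (Q j).star
    · rw [Set.indicator_of_mem hx, Real.norm_of_nonneg ENNReal.toReal_nonneg]
      refine ENNReal.toReal_mono hB (ENNReal.rpow_le_rpow (Finset.sum_le_sum fun j _ => ?_) hq.le)
      exact mul_le_of_le_one_right' (Set.indicator_le_self' (by simp) x)
    · have h0 : ∀ j ∈ Finset.range N, c j * (Q j).star.indicator (fun _ => (1 : ℝ≥0∞)) x = 0 :=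
        fun j hj => by
          have : x ∉ (Q j).star := fun h => hx (Set.mem_biUnion hj h)
          simp [this]
      rw [Finset.sum_eq_zero h0, Set.indicator_of_notMem hx]
      simp [hq]

theorem power_rpow (X : FunctionNorm n) {p : ℝ} (hp : 0 < p) (f : Rn n → ℝ≥0∞) :
    power X (1 / p) (fun x => f x ^ p) = X f ^ p := by
  have h : ∀ x, (f x ^ p) ^ (1 / p) = f x := fun x => by
    rw [← ENNReal.rpow_mul, mul_one_div_cancel hp.ne', ENNReal.rpow_one]
  simp only [power, h, one_div_one_div]

theorem power_associate_mono {r : ℝ} (hr : 0 < r) {f g : Rn n → ℝ≥0∞} (h : ∀ᵐ x, f x ≤ g x) :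
    power (associate ρ) r f ≤ power (associate ρ) r g :=
  ENNReal.rpow_le_rpow (associate_mono (h.mono fun _ hx => ENNReal.rpow_le_rpow hx hr.le))
    (by positivity)

theorem power_associate_const_mul {r : ℝ} (hr : 0 < r) (c : ℝ≥0) (f : Rn n → ℝ≥0∞) :
    power (associate ρ) r (fun x => c * f x) = c * power (associate ρ) r f := by
  simp only [power]
  simp_rw [ENNReal.mul_rpow_of_nonneg _ _ hr.le, ← ENNReal.coe_rpow_of_nonneg c hr.le]
  rw [associate_const_mul, ENNReal.mul_rpow_of_nonneg _ _ (by positivity),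
    ENNReal.coe_rpow_of_nonneg c hr.le, ← ENNReal.rpow_mul, mul_one_div_cancel hr.ne',
    ENNReal.rpow_one]

theorem exists_bound_finite_sum {X Y : FunctionNorm n} {p q s : ℝ} (hp : 0 < p)
    (hpq : p < q) (hq1 : q ≤ 1) (hs : 0 ≤ s) (hexp : q / p = 1 + s * q)
    (hXp : IsBallBanach (power X (1 / p))) (hYq : IsBallBanach (power Y (1 / q)))
    (hdual : space (associate (power Y (1 / q))) ⊆
      space (power (associate (power X (1 / p))) (p / q)))
    (hM : MaximalBounded (associate (power Y (1 / q)))) :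
    ∃ C : ℝ≥0, 0 < C ∧ ∀ (l : ℕ → ℝ≥0∞) (Q : ℕ → Cube n), (∀ j, l j ≠ 0) → (∀ j, l j ≠ ∞) →
      ∀ N : ℕ,
      Y (fun x => ∑ j ∈ Finset.range N,
          l j * volume (Q j).toSet ^ s * (Q j).star.indicator (fun _ => 1) x) ≤
        C * X (fun x => ∑ j ∈ Finset.range N, l j * (Q j).toSet.indicator (fun _ => 1) x) := by
  have hq : 0 < q := hp.trans hpq
  have hr : 0 < p / q := by positivity
  obtain ⟨C₁, hC₁, hweight⟩ := hYq.exists_weight hM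
  obtain ⟨C₂, hembed⟩ := hYq.exists_bound_of_space_subset
    (σ := power (associate (power X (1 / p))) (p / q))
    (fun f g h => power_associate_mono hr h) (fun c f => power_associate_const_mul hr c f) hdual
  obtain ⟨K, hK, hfrac⟩ := lintegral_rpow_sum_star_le n C₁ hC₁ hp hpq hq1 hs hexp
  lift K to ℝ≥0 using hK
  -- The added 1 keeps the constant positive, which also settles the case where F has infinite norm.
  set B : ℝ≥0 := K * (2 * C₂) + 1
  have hB : 0 < B := by positivity
  refine ⟨B ^ (1 / q), NNReal.rpow_pos hB, fun l Q hl hl' N => ?_⟩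
  set F : Rn n → ℝ≥0∞ :=
    fun x => ∑ j ∈ Finset.range N, l j * (Q j).toSet.indicator (fun _ => 1) x
  set G : Rn n → ℝ≥0∞ := fun x => ∑ j ∈ Finset.range N,
    l j * volume (Q j).toSet ^ s * (Q j).star.indicator (fun _ => 1) x
  have hc : ∀ j, l j * volume (Q j).toSet ^ s ≠ ∞ := fun j =>
    ENNReal.mul_ne_top (hl' j) (ENNReal.rpow_ne_top_of_nonneg hs (Q j).volume_ne_top)
  have hFm : Measurable F := Finset.measurable_sum _ fun j _ =>
    (measurable_const.indicator (Q j).measurableSet_toSet).const_mul _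
  have hGm : Measurable G := Finset.measurable_sum _ fun j _ =>
    (measurable_const.indicator (Q j).measurableSet_star).const_mul _
  have hGt : ∀ x, G x ^ q ≠ ∞ := fun x => by
    refine ENNReal.rpow_ne_top_of_nonneg hq.le (ENNReal.sum_lt_top.mpr fun j _ => ?_).ne
    by_cases hx : x ∈ (Q j).star <;> simp [hx, (hc j).lt_top]
  have hB' : ((B ^ (1 / q) : ℝ≥0) : ℝ≥0∞) = (B : ℝ≥0∞) ^ (1 / q) :=
    ENNReal.coe_rpow_of_nonneg _ (by positivity)
  rcases eq_or_ne (X F) ∞ with htop | htop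
  · rw [htop, ENNReal.mul_top]
    · exact le_top
    · exact_mod_cast (NNReal.rpow_pos hB).ne'
  obtain ⟨t, ht⟩ := WithTop.ne_top_iff_exists.mp htop
  change (t : ℝ≥0∞) = _ at ht
  have hXF : power X (1 / p) (fun x => F x ^ p) = (t : ℝ≥0∞) ^ p := by rw [power_rpow X hp, ht]
  have hmain : power Y (1 / q) (fun x => G x ^ q) ≤ (B * t ^ q : ℝ≥0) := by
    refine hYq.le_of_duality (hGm.pow_const _).aemeasurable hGt
      (memLp_rpow_sum_star hc Q hq N) fun g hg hg1 => ?_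
    obtain ⟨W, hWm, hgW, hW2, hWM⟩ := hweight g hg hg1
    have hholder := hXp.lintegral_mul_le (f := fun x => F x ^ p) (g := fun x => W x ^ (p / q))
      (hFm.pow_const _).aemeasurable
      (by rw [hXF]; exact ENNReal.rpow_lt_top_of_nonneg hp.le ENNReal.coe_ne_top)
    have hWX : (associate (power X (1 / p)) fun x => W x ^ (p / q)) ^ (q / p) ≤ 2 * C₂ := by
      -- The weight has norm at most 2, so half of it lies in the unit ball.
      have h1 := hembed (fun x => (2⁻¹ : ℝ≥0) * W x) (hWm.const_mul _) (by
        rw [associate_const_mul, ENNReal.coe_inv two_ne_zero,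
          ENNReal.inv_mul_le_iff (by simp) (by simp)]
        simpa using hW2)
      rw [power_associate_const_mul hr, ENNReal.coe_inv two_ne_zero,
          ENNReal.inv_mul_le_iff (by simp) (by simp)] at h1
      simpa [power] using h1
    calc ∫⁻ x, G x ^ q * g x ≤ ∫⁻ x, G x ^ q * W x :=
          lintegral_mono fun x => mul_le_mul_right (hgW x) _
      _ ≤ K * (∫⁻ x, F x ^ p * W x ^ (p / q)) ^ (q / p) := hfrac W hWm hWM l Q hl hl' N
      _ ≤ K * ((t : ℝ≥0∞) ^ p * associate (power X (1 / p)) fun x => W x ^ (p / q)) ^ (q / p) := by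
          rw [hXF] at hholder
          gcongr
      _ = K * ((t : ℝ≥0∞) ^ q *
            (associate (power X (1 / p)) fun x => W x ^ (p / q)) ^ (q / p)) := by
          rw [ENNReal.mul_rpow_of_nonneg _ _ (by positivity), ← ENNReal.rpow_mul,
            mul_div_cancel₀ q hp.ne']
      _ ≤ K * ((t : ℝ≥0∞) ^ q * (2 * C₂)) := by gcongr
      _ = ((K * (2 * C₂) : ℝ≥0) : ℝ≥0∞) * (t : ℝ≥0∞) ^ q := by push_cast; ring
      _ ≤ (B * t ^ q : ℝ≥0) := by
          rw [ENNReal.coe_mul B, ENNReal.coe_rpow_of_nonneg t hq.le]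
          gcongr
          exact le_self_add
  rw [power_rpow Y hq, ENNReal.coe_mul, ENNReal.coe_rpow_of_nonneg t hq.le, ht] at hmain
  have h := ENNReal.rpow_le_rpow hmain (show 0 ≤ 1 / q by positivity)
  rwa [ENNReal.mul_rpow_of_nonneg _ _ (by positivity), ← ENNReal.rpow_mul, ← ENNReal.rpow_mul,
    mul_one_div_cancel hq.ne', ENNReal.rpow_one, ENNReal.rpow_one, ← hB'] at h

end FunctionNorms

end BallSpace

theorem lemma2p4 (n : ℕ) (X Y : BallSpace.FunctionNorm n)
    (hX : BallSpace.IsBallQuasiBanach X) (hY : BallSpace.IsBallQuasiBanach Y)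
    (α p₀ q₀ : ℝ) (hα : 0 < α) (hαn : α < n)
    (hp₀ : 0 < p₀) (hpq : p₀ < q₀) (hq₀ : q₀ ≤ 1)
    (hexp : 1 / q₀ = 1 / p₀ - α / n)
    (hXp : BallSpace.IsBallBanach (BallSpace.power X (1 / p₀)))
    (hYq : BallSpace.IsBallBanach (BallSpace.power Y (1 / q₀)))
    (hdual : BallSpace.space (BallSpace.associate (BallSpace.power Y (1 / q₀))) =
      BallSpace.space (BallSpace.power (BallSpace.associate (BallSpace.power X (1 / p₀))) (p₀ / q₀)))
    (hM : BallSpace.MaximalBounded (BallSpace.associate (BallSpace.power Y (1 / q₀)))) :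
    ∃ C : ℝ≥0, 0 < C ∧ ∀ (lam : ℕ → ℝ) (Q : ℕ → BallSpace.Cube n), (∀ j, 0 < lam j) →
      Y (fun x => ∑' j, ENNReal.ofReal (lam j) * volume (Q j).toSet ^ (α / n) *
          (Q j).star.indicator (fun _ => 1) x) ≤
        C * X (fun x => ∑' j, ENNReal.ofReal (lam j) * (Q j).toSet.indicator (fun _ => 1) x) := by
  have hq : 0 < q₀ := hp₀.trans hpq
  have hs : 0 ≤ α / n := by positivity
  have he : q₀ / p₀ = 1 + α / n * q₀ := by
    have h1 : 1 / p₀ = 1 / q₀ + α / n := by linarith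
    rw [div_eq_mul_one_div, h1, mul_add, mul_one_div_cancel hq.ne', mul_comm q₀]
  obtain ⟨C, hC, h⟩ := BallSpace.exists_bound_finite_sum hp₀ hpq hq₀ hs he hXp hYq hdual.le hM
  refine ⟨C, hC, fun lam Q hlam => ?_⟩
  have hFm : ∀ j, Measurable fun x => ENNReal.ofReal (lam j) *
      (Q j).toSet.indicator (fun _ => (1 : ℝ≥0∞)) x := fun j =>
    (measurable_const.indicator (Q j).measurableSet_toSet).const_mul _
  have hGm : ∀ j, Measurable fun x => ENNReal.ofReal (lam j) * volume (Q j).toSet ^ (α / n) *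
      (Q j).star.indicator (fun _ => (1 : ℝ≥0∞)) x := fun j =>
    (measurable_const.indicator (Q j).measurableSet_star).const_mul _
  refine le_of_tendsto' (hY.fatou (fun N x => ∑ j ∈ Finset.range N,
    ENNReal.ofReal (lam j) * volume (Q j).toSet ^ (α / n) * (Q j).star.indicator (fun _ => 1) x)
    _ (fun N => (Finset.measurable_sum _ fun j _ => hGm j).aemeasurable)
    (Measurable.tsum hGm).aemeasurable
    (Eventually.of_forall fun x a b hab =>
      Finset.sum_le_sum_of_subset (Finset.range_subset_range.mpr hab))
    (Eventually.of_forall fun x => ENNReal.tendsto_nat_tsum _)) fun N => ?_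
  refine (h _ Q (fun j => by simpa using hlam j) (fun j => ENNReal.ofReal_ne_top) N).trans ?_
  gcongr
  exact hX.mono _ _ (Measurable.tsum hFm).aemeasurable
    (Finset.measurable_sum _ fun j _ => hFm j).aemeasurable
    (Eventually.of_forall fun x => ENNReal.sum_le_tsum _)
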